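/- Let $(K,v)$ be a non-trivially valued algebraically closed field with value group $\Gamma$ (written additively, $v\colon K\to\Gamma\cup\{\infty\}$ surjective), viewed as a structure in the language $\mathcal L_{div}=(+,-,\cdot,0,1,\mathrm{div})$, where $\mathrm{div}(x,y)$ means $v(x)\le v(y)$. Let $\mathcal L\supseteq\mathcal L_{div}$, and let $(K,\mathcal L)$ be an expansion of $(K,\mathcal L_{div})$ that is *$C$-minimal*: in every $\mathcal L$-structure $K'$ elementarily equivalent to $(K,\mathcal L)$, every subset of $K'$ definable with parameters is a boolean combination of balls. "Definable" means $\mathcal L$-definable with parameters; subsets of products $K^n\times\Gamma^m$ are definable if their preimage in $K^n\times(K^\times)^m$ under $v$ is definable. An open ball is a set $\{x\in K: v(x-a)>\gamma\}$ with $a\in K$, $\gamma\in\Gamma\cup\{-\infty\}$. Put $C(x,y,z):\Leftrightarrow v(x-y)=v(x-z)<v(y-z)$. For an open ball $B$, a function $f\colon B\to K$ is a *$C$-isomorphism* if $f(B)$ is an open ball and $C(x,y,z)\Leftrightarrow C(f(x),f(y),f(z))$ for all $x,y,z\in B$. A function $f\colon X\subseteq K\to K$ is a *local $C$-isomorphism*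 if every $x\in X$ lies in an open ball $B\subseteq X$ such that $f|B$ is a $C$-isomorphism. For $h\colon Y\subseteq X\times\Gamma\to\Gamma$ and $x\in X$ let $h_x$ be the function $\gamma\mapsto h(x,\gamma)$ with domain $\{\gamma:(x,\gamma)\in Y\}$. We say that $f$ *locally factorizes over $\Gamma$ through $h$* if every $x\in X$ lies in an open ball $B_x\subseteq X$ such that for all distinct $y,z\in B_x$, $h_x$ is defined at $v(y-z)$ and $v(f(y)-f(z))=h_x(v(y-z))$. Then: 1. Let $f\colon X\subseteq K\to K$ be a definable local $C$-isomorphism. There are a finite set $F\subseteq X$ and a definable function $h\colon Y\subseteq (X\setminus F)\times\Gamma\to\Gamma$, where $Y$ projects onto $X\setminus F$, such that $f|(X\setminus F)$ locally factorizes over $\Gamma$ through $h$. 2. (Uniform version.) Let $n\in\mathbb N$, let $W\subseteq K^n$ be definable, let $X\subseteq W\times K$ project onto $W$, and let $f\colon X\to K$ be definable and such that for every $w\in W$ the function $f_w=f(w,\cdot)\colon X_w\to K$ is a local $C$-isomorphism, where $X_w=\{x:(w,x)\in X\}$. There are a definable function $h\colon Y\subseteq X\times\Gamma\to\Gamma$,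 where $Y$ projects onto $X$, and a definable set $F\subseteq X$ such that for every $w\in W$ the fiber $F_w$ is finite and $f_w|(X_w\setminus F_w)$ locally factorizes over $\Gamma$ through $h_w$, where $h_w(x,\gamma)=h((w,x),\gamma)$. -/

import Mathlib

open FirstOrder

universe u₁ u₂ u₃

namespace CMinimal

/-! ### The language of valued fields and `C`-minimality -/

/-- The relation symbols of the language of valued fields: one binary predicate `div`. -/
inductive DivRel : ℕ → Type
  | div : DivRel 2

/-- The language of valued fields `(+, *, -, 0, 1, div)`. -/
def Ldiv : FirstOrder.Language.{0, 0} where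
  Functions := ringFunc
  Relations := DivRel

/-- The difference `x - y`, computed in an `Ldiv`-structure. -/
def sub {M : Type*} [Ldiv.Structure M] (x y : M) : M :=
  Language.Structure.funMap (L := Ldiv) ringFunc.add
    ![x, Language.Structure.funMap (L := Ldiv) ringFunc.neg ![y] ]

/-- The relation `div(x, y)`, which reads `v(x) ≤ v(y)`, in an `Ldiv`-structure. -/
def div {M : Type*} [Ldiv.Structure M] (x y : M) : Prop :=
  Language.Structure.RelMap (L := Ldiv) DivRel.div ![x, y]

/-- The balls of an `Ldiv`-structure: the whole structure, the closed balls
`{x | v(c) ≤ v(x - a)}` and the open balls `{x | v(c) < v(x - a)}`.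
(For `c = 0` these are the singleton `{a}`, a closed ball of radius `+∞`, and the empty set.) -/
def balls (M : Type*) [Ldiv.Structure M] : Set (Set M) :=
  {S | S = Set.univ ∨ (∃ a c : M, S = {x | div c (sub x a)}) ∨
    ∃ a c : M, S = {x | ¬ div (sub x a) c}}

/-- `C`-minimality of an `L`-structure `K`, where `L` is a language extending `Ldiv` (by means
of `ι`): in every `L`-structure elementarily equivalent to `K`, every subset of the universe
definable with parameters is a boolean combination of balls. -/
def IsCMinimal {L : FirstOrder.Language.{u₁, u₂}} (ι : Ldiv →ᴸ L) (K : Type u₃) [L.Structure K] : Prop :=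
  ∀ (M : Type (max u₁ u₂ u₃)) [L.Structure M], L.ElementarilyEquivalent K M →
    ∀ X : Set M, (Set.univ : Set M).Definable₁ L X →
      X ∈ BooleanSubalgebra.closure (@balls M (ι.reduct M))

variable {K : Type*} [Field K] {Γ : Type*} [AddCommGroup Γ] [LinearOrder Γ] [IsOrderedAddMonoid Γ]

/-- A valued field `(K, v)` as an `Ldiv`-structure: the ring operations have their usual
interpretation, and `div(x, y)` holds if and only if `v x ≤ v y`. -/
@[reducible]
def valuedFieldStructure (v : AddValuation K (WithTop Γ)) : Ldiv.Structure K where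
  funMap := fun {_} f =>
    match f with
    | ringFunc.add => fun x => x 0 + x 1
    | ringFunc.mul => fun x => x 0 * x 1
    | ringFunc.neg => fun x => -x 0
    | ringFunc.zero => fun _ => 0
    | ringFunc.one => fun _ => 1
  RelMap := fun {_} r =>
    match r with
    | DivRel.div => fun x => v (x 0) ≤ v (x 1)

/-! ### Definable sets and functions involving the value group -/

/-- Definability, with parameters, of a subset of `K^α × Γ^β`, where the value group `Γ` is
viewed as the quotient of `K^×` by the relation `v x = v y`: the preimage of the set in
`K^α × (K^×)^β` is `L`-definable. -/
def DefinableVal (L : FirstOrder.Language.{u₁, u₂}) [L.Structure K] (v : AddValuation K (WithTop Γ))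
    {α β : Type} (S : Set ((α → K) × (β → Γ))) : Prop :=
  (Set.univ : Set K).Definable L
    {t : α ⊕ β → K | ∃ γ : β → Γ, (∀ j, v (t (Sum.inr j)) = (γ j : WithTop Γ)) ∧
      (fun i => t (Sum.inl i), γ) ∈ S}

/-- `X ⊆ K^n × K` is `L`-definable with parameters. -/
def DefinableFam (L : FirstOrder.Language.{u₁, u₂}) [L.Structure K] {n : ℕ}
    (X : Set ((Fin n → K) × K)) : Prop :=
  (Set.univ : Set K).Definable L
    {t : Fin n ⊕ Fin 1 → K | (fun i => t (Sum.inl i), t (Sum.inr 0)) ∈ X}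

/-- The function `f : X ⊆ K^n × K → K` is definable: its graph is. (Here and below a function on
a subset `X` is given by a total function of which only the restriction to `X` is considered.) -/
def DefinableFunFam (L : FirstOrder.Language.{u₁, u₂}) [L.Structure K] {n : ℕ}
    (X : Set ((Fin n → K) × K)) (f : (Fin n → K) → K → K) : Prop :=
  (Set.univ : Set K).Definable L
    {t : Fin n ⊕ Fin 2 → K | (fun i => t (Sum.inl i), t (Sum.inr 0)) ∈ X ∧
      f (fun i => t (Sum.inl i)) (t (Sum.inr 0)) = t (Sum.inr 1)}

/-- The function `h : Y ⊆ K × Γ → Γ` is definable: its graph is. -/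
def DefinableValFun (L : FirstOrder.Language.{u₁, u₂}) [L.Structure K] (v : AddValuation K (WithTop Γ))
    (Y : Set (K × Γ)) (h : K → Γ → Γ) : Prop :=
  DefinableVal L v {p : (Fin 1 → K) × (Fin 2 → Γ) |
    (p.1 0, p.2 0) ∈ Y ∧ h (p.1 0) (p.2 0) = p.2 1}

/-- The function `h : Y ⊆ (K^n × K) × Γ → Γ` is definable: its graph is. -/
def DefinableValFunFam (L : FirstOrder.Language.{u₁, u₂}) [L.Structure K] (v : AddValuation K (WithTop Γ))
    {n : ℕ} (Y : Set (((Fin n → K) × K) × Γ)) (h : (Fin n → K) → K → Γ → Γ) : Prop :=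
  DefinableVal L v {p : (Fin n ⊕ Fin 1 → K) × (Fin 2 → Γ) |
    ((fun i => p.1 (Sum.inl i), p.1 (Sum.inr 0)), p.2 0) ∈ Y ∧
      h (fun i => p.1 (Sum.inl i)) (p.1 (Sum.inr 0)) (p.2 0) = p.2 1}

/-! ### Local `C`-isomorphisms and local factorization over the value group -/

/-- Open balls: `{x | γ < v (x - a)}` with `γ` in the value group, or (`γ = -∞`) all of `K`. -/
def IsOpenBall (v : AddValuation K (WithTop Γ)) (B : Set K) : Prop :=
  B = Set.univ ∨ ∃ (a : K) (γ : Γ), B = {x | (γ : WithTop Γ) < v (x - a)}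

/-- The `C`-relation. -/
def CRel (v : AddValuation K (WithTop Γ)) (x y z : K) : Prop :=
  v (x - y) = v (x - z) ∧ v (x - z) < v (y - z)

/-- `f` restricted to `B` is a `C`-isomorphism. -/
def IsCIso (v : AddValuation K (WithTop Γ)) (B : Set K) (f : K → K) : Prop :=
  IsOpenBall v B ∧ IsOpenBall v (f '' B) ∧
    ∀ x ∈ B, ∀ y ∈ B, ∀ z ∈ B, CRel v x y z ↔ CRel v (f x) (f y) (f z)

/-- `f : X → K` is a local `C`-isomorphism. -/
def IsLocalCIso (v : AddValuation K (WithTop Γ)) (X : Set K) (f : K → K) : Prop :=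
  ∀ x ∈ X, ∃ B : Set K, x ∈ B ∧ B ⊆ X ∧ IsCIso v B f

/-- `f : B → K` factorizes over `Γ` through `h : D ⊆ Γ → Γ`: for all distinct `y, z` in `B`,
`v (f y - f z) = h (v (y - z))` (in particular `v (y - z) ∈ D`). -/
def FactorizesThrough (v : AddValuation K (WithTop Γ)) (B : Set K) (f : K → K)
    (D : Set Γ) (h : Γ → Γ) : Prop :=
  ∀ y ∈ B, ∀ z ∈ B, y ≠ z →
    ∃ γ ∈ D, v (y - z) = (γ : WithTop Γ) ∧ v (f y - f z) = (h γ : WithTop Γ)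

/-- `f : X → K` locally factorizes over `Γ` through `h`, where `h x` is a function
`D x ⊆ Γ → Γ` for every `x ∈ X`. -/
def LocallyFactorizesThrough (v : AddValuation K (WithTop Γ)) (X : Set K) (f : K → K)
    (D : K → Set Γ) (h : K → Γ → Γ) : Prop :=
  ∀ x ∈ X, ∃ B : Set K, IsOpenBall v B ∧ x ∈ B ∧ B ⊆ X ∧ FactorizesThrough v B f (D x) (h x)

end CMinimal

/-! Attach to each x the scaling relation of f at x: it sends γ to η if some y in the domain has v(x
- y) = γ, and every such y satisfies v(f x - f y) = η. A C-isomorphism preserves equidistance from a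
point, so inside a closed ball on which f is a C-isomorphism each point scales every occurring
distance to a single value. What remains is to compare the scalings at neighbouring points.

Call x bad if f does not factorize near x through the scaling relation at x. The bad set is
definable; if infinite, it contains by C-minimality a closed ball of some radius δ on which f is a
C-isomorphism. Its residue classes are the open balls of radius δ inside it. A definable subset of
the closed ball, or its complement there, meets only finitely many classes
(`thin_inter_or_thin_diff`), whereas a definable subset of Γ is constant between finitely many
breakpoints (`isTame_of_dfn`), so an infinite one can be cut into two infinite definable pieces.
Hence a definable relation between classes and Γ with finite fibres over Γ involves only finitely
many classes (`thin_of_thin_fibers`).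

This is used twice. With thresholds separating two values as second coordinate, it shows that for
fixed γ the scaled value is constant on all but finitely many classes (`thin_setOf_not_constant`).
With γ itself as second coordinate, it shows that all but finitely many classes are good for all γ
at once. The residue field is infinite (`not_thin_closedBall`), so a good class exists; its points
are not bad, a contradiction.

The uniform version needs no compactness: the scaling relation and badness are defined by formulas
with the parameter as a variable, and finiteness is checked fibre by fibre. -/

namespace CMinimal

open Language

variable {K : Type u₃} [Field K] {Γ : Type*} [AddCommGroup Γ] [LinearOrder Γ]
  [IsOrderedAddMonoid Γ]

/-! ### A two-sorted calculus of definable predicates -/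

/-- `g` is given by a term with parameters. -/
def IsTermFun (L : FirstOrder.Language.{u₁, u₂}) [L.Structure K] {α : Type}
    (g : (α → K) → K) : Prop :=
  ∃ τ : L[[(Set.univ : Set K)]].Term α, ∀ t, τ.realize t = g t

/-- `k` is lifted to the field by a term with parameters. -/
def IsValTermFun (L : FirstOrder.Language.{u₁, u₂}) [L.Structure K] (v : AddValuation K (WithTop Γ))
    {β : Type} (k : (β → Γ) → Γ) : Prop :=
  ∃ τ : L[[(Set.univ : Set K)]].Term β, ∀ (s : β → K) (γ : β → Γ),
    (∀ j, v (s j) = (γ j : WithTop Γ)) → v (τ.realize s) = (k γ : WithTop Γ)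

/-- `V` is the valuation of a term with parameters. -/
def IsValuedTerm (L : FirstOrder.Language.{u₁, u₂}) [L.Structure K] (v : AddValuation K (WithTop Γ))
    {α β : Type} (V : (α → K) → (β → Γ) → WithTop Γ) : Prop :=
  ∃ τ : L[[(Set.univ : Set K)]].Term (α ⊕ β), ∀ (t : α → K) (s : β → K) (γ : β → Γ),
    (∀ j, v (s j) = (γ j : WithTop Γ)) → v (τ.realize (Sum.elim t s)) = V t γ

/-- The predicate `P` on `K^α × Γ^β` is definable with parameters: some formula defines its
preimage in `K^α × (K^×)^β`. -/
def Dfn (L : FirstOrder.Language.{u₁, u₂}) [L.Structure K] (v : AddValuation K (WithTop Γ))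
    {α β : Type} (P : (α → K) → (β → Γ) → Prop) : Prop :=
  ∃ φ : L[[(Set.univ : Set K)]].Formula (α ⊕ β), ∀ (t : α → K) (s : β → K) (γ : β → Γ),
    (∀ j, v (s j) = (γ j : WithTop Γ)) → (φ.Realize (Sum.elim t s) ↔ P t γ)

section

set_option linter.unusedSectionVars false

variable {L : FirstOrder.Language.{u₁, u₂}} [L.Structure K] {v : AddValuation K (WithTop Γ)}
  {α β α' β' : Type}

theorem isTermFun_var (i : α) : IsTermFun L (fun t : α → K => t i) :=
  ⟨Term.var i, fun _ => rfl⟩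

theorem isTermFun_const (c : K) : IsTermFun L (fun _ : α → K => c) :=
  ⟨(L.con (⟨c, trivial⟩ : (Set.univ : Set K))).term, fun _ => Term.realize_con⟩

theorem isValTermFun_var (j : β) : IsValTermFun L v (fun γ : β → Γ => γ j) :=
  ⟨Term.var j, fun _ _ h => h j⟩

theorem isValTermFun_const (hv : Function.Surjective v) (c : Γ) :
    IsValTermFun L v (fun _ : β → Γ => c) := by
  obtain ⟨a, ha⟩ := hv c
  refine ⟨(L.con (⟨a, trivial⟩ : (Set.univ : Set K))).term, fun s γ _ => ?_⟩
  rw [Term.realize_con]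
  exact ha

theorem IsValTermFun.isValuedTerm {k : (β → Γ) → Γ} (h : IsValTermFun L v k) :
    IsValuedTerm L v (fun (_ : α → K) γ => (k γ : WithTop Γ)) := by
  obtain ⟨τ, hτ⟩ := h
  refine ⟨τ.relabel Sum.inr, fun t s γ hs => ?_⟩
  rw [Term.realize_relabel, Sum.elim_comp_inr]
  exact hτ s γ hs

theorem IsTermFun.isValuedTerm {g : (α → K) → K} (h : IsTermFun L g) :
    IsValuedTerm L v (fun t (_ : β → Γ) => v (g t)) := by
  obtain ⟨τ, hτ⟩ := h
  refine ⟨τ.relabel Sum.inl, fun t s γ hs => ?_⟩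
  rw [Term.realize_relabel, Sum.elim_comp_inl, hτ t]

/-! ### Interpretation of the valued field symbols -/

theorem funMap_onFunction {ι : Ldiv →ᴸ L} (hι : ι.reduct K = valuedFieldStructure v) {n : ℕ}
    (f : Ldiv.Functions n) (x : Fin n → K) :
    Structure.funMap (L := L) (ι.onFunction f) x =
      (valuedFieldStructure v).funMap f x := by
  rw [← hι]; rfl

theorem relMap_onRelation {ι : Ldiv →ᴸ L} (hι : ι.reduct K = valuedFieldStructure v) {n : ℕ}
    (r : Ldiv.Relations n) (x : Fin n → K) :
    Structure.RelMap (L := L) (ι.onRelation r) x ↔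
      (valuedFieldStructure v).RelMap r x := by
  rw [← hι]; rfl

theorem realize_apply₁_onFunction {ι : Ldiv →ᴸ L} (hι : ι.reduct K = valuedFieldStructure v)
    (f : Ldiv.Functions 1) (τ : L[[(Set.univ : Set K)]].Term α) (t : α → K) :
    (Functions.apply₁ (L := L[[(Set.univ : Set K)]]) ((L.lhomWithConstants _).onFunction (ι.onFunction f)) τ).realize t =
      (valuedFieldStructure v).funMap f ![τ.realize t] := by
  rw [Term.realize_functions_apply₁, LHom.map_onFunction, funMap_onFunction hι]

theorem realize_apply₂_onFunction {ι : Ldiv →ᴸ L} (hι : ι.reduct K = valuedFieldStructure v)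
    (f : Ldiv.Functions 2) (τ τ' : L[[(Set.univ : Set K)]].Term α) (t : α → K) :
    (Functions.apply₂ (L := L[[(Set.univ : Set K)]]) ((L.lhomWithConstants _).onFunction (ι.onFunction f)) τ τ').realize t =
      (valuedFieldStructure v).funMap f ![τ.realize t, τ'.realize t] := by
  rw [Term.realize_functions_apply₂, LHom.map_onFunction, funMap_onFunction hι]

theorem realize_formula₂_onRelation {ι : Ldiv →ᴸ L} (hι : ι.reduct K = valuedFieldStructure v)
    (r : Ldiv.Relations 2) (τ τ' : L[[(Set.univ : Set K)]].Term α) (t : α → K) :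
    (Relations.formula₂ (L := L[[(Set.univ : Set K)]]) ((L.lhomWithConstants _).onRelation (ι.onRelation r)) τ τ').Realize t ↔
      (valuedFieldStructure v).RelMap r ![τ.realize t, τ'.realize t] := by
  rw [Formula.realize_rel₂, LHom.map_onRelation, relMap_onRelation hι]

theorem IsTermFun.add {ι : Ldiv →ᴸ L} (hι : ι.reduct K = valuedFieldStructure v)
    {g g' : (α → K) → K} (h : IsTermFun L g) (h' : IsTermFun L g') :
    IsTermFun L (fun t => g t + g' t) := by
  obtain ⟨τ, hτ⟩ := h
  obtain ⟨τ', hτ'⟩ := h'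
  refine ⟨Functions.apply₂ ((L.lhomWithConstants _).onFunction (ι.onFunction ringFunc.add)) τ τ', fun t => ?_⟩
  refine (realize_apply₂_onFunction hι _ τ τ' t).trans ?_
  rw [hτ, hτ']
  rfl

theorem IsTermFun.neg {ι : Ldiv →ᴸ L} (hι : ι.reduct K = valuedFieldStructure v)
    {g : (α → K) → K} (h : IsTermFun L g) : IsTermFun L (fun t => -g t) := by
  obtain ⟨τ, hτ⟩ := h
  refine ⟨Functions.apply₁ ((L.lhomWithConstants _).onFunction (ι.onFunction ringFunc.neg)) τ, fun t => ?_⟩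
  refine (realize_apply₁_onFunction hι _ τ t).trans ?_
  rw [hτ]
  rfl

theorem IsTermFun.sub {ι : Ldiv →ᴸ L} (hι : ι.reduct K = valuedFieldStructure v)
    {g g' : (α → K) → K} (h : IsTermFun L g) (h' : IsTermFun L g') :
    IsTermFun L (fun t => g t - g' t) := by
  simpa only [sub_eq_add_neg] using h.add hι (h'.neg hι)

theorem IsValTermFun.add {ι : Ldiv →ᴸ L} (hι : ι.reduct K = valuedFieldStructure v)
    {k k' : (β → Γ) → Γ} (h : IsValTermFun L v k) (h' : IsValTermFun L v k') :
    IsValTermFun L v (fun γ => k γ + k' γ) := by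
  obtain ⟨τ, hτ⟩ := h
  obtain ⟨τ', hτ'⟩ := h'
  refine ⟨Functions.apply₂ ((L.lhomWithConstants _).onFunction (ι.onFunction ringFunc.mul)) τ τ', fun s γ hs => ?_⟩
  refine (congrArg v (realize_apply₂_onFunction hι _ τ τ' s)).trans ?_
  rw [WithTop.coe_add, ← hτ s γ hs, ← hτ' s γ hs, ← v.map_mul]
  rfl

/-! ### Closure properties of definable predicates -/

namespace Dfn

theorem congr {P Q : (α → K) → (β → Γ) → Prop} (h : Dfn L v P) (e : ∀ t γ, P t γ ↔ Q t γ) :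
    Dfn L v Q := by
  obtain ⟨φ, hφ⟩ := h
  exact ⟨φ, fun t s γ hs => (hφ t s γ hs).trans (e t γ)⟩

theorem not {P : (α → K) → (β → Γ) → Prop} (h : Dfn L v P) : Dfn L v (fun t γ => ¬ P t γ) := by
  obtain ⟨φ, hφ⟩ := h
  exact ⟨∼φ, fun t s γ hs => by rw [Formula.realize_not, hφ t s γ hs]⟩

theorem and {P Q : (α → K) → (β → Γ) → Prop} (h : Dfn L v P) (h' : Dfn L v Q) :
    Dfn L v (fun t γ => P t γ ∧ Q t γ) := by
  obtain ⟨φ, hφ⟩ := h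
  obtain ⟨ψ, hψ⟩ := h'
  exact ⟨φ ⊓ ψ, fun t s γ hs => by rw [Formula.realize_inf, hφ t s γ hs, hψ t s γ hs]⟩

theorem imp {P Q : (α → K) → (β → Γ) → Prop} (h : Dfn L v P) (h' : Dfn L v Q) :
    Dfn L v (fun t γ => P t γ → Q t γ) :=
  (h.and h'.not).not.congr fun t γ => by tauto

theorem ex {P : (α → K) → (β → Γ) → K → Prop}
    (h : Dfn L v (fun (t : α ⊕ Unit → K) γ => P (fun i => t (Sum.inl i)) γ (t (Sum.inr ())))) :
    Dfn L v (fun t γ => ∃ x, P t γ x) := by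
  obtain ⟨φ, hφ⟩ := h
  refine ⟨(φ.relabel (Sum.elim (Sum.elim (Sum.inl ∘ Sum.inl) Sum.inr)
    (Sum.inl ∘ Sum.inr)) : L[[(Set.univ : Set K)]].Formula ((α ⊕ β) ⊕ Unit)).iExs Unit,
    fun t s γ hs => ?_⟩
  have key : ∀ x : Unit → K, ((φ.relabel (Sum.elim (Sum.elim (Sum.inl ∘ Sum.inl) Sum.inr)
      (Sum.inl ∘ Sum.inr)) : L[[(Set.univ : Set K)]].Formula ((α ⊕ β) ⊕ Unit)).Realize
      (Sum.elim (Sum.elim t s) x) ↔ P t γ (x ())) := fun x => by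
    refine Iff.trans (iff_of_eq ?_) (hφ (Sum.elim t x) s γ hs)
    rw [Formula.realize_relabel]
    congr 1
    funext i
    rcases i with (i | i) | i <;> rfl
  rw [Formula.realize_iExs]
  exact ⟨fun ⟨x, hx⟩ => ⟨x (), (key x).1 hx⟩, fun ⟨x, hx⟩ => ⟨fun _ => x, (key _).2 hx⟩⟩

theorem all {P : (α → K) → (β → Γ) → K → Prop}
    (h : Dfn L v (fun (t : α ⊕ Unit → K) γ => P (fun i => t (Sum.inl i)) γ (t (Sum.inr ())))) :
    Dfn L v (fun t γ => ∀ x, P t γ x) :=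
  (ex (P := fun t γ x => ¬ P t γ x) h.not).not.congr fun t γ => by simp

theorem exVal (hv : Function.Surjective v) {P : (α → K) → (β → Γ) → Γ → Prop}
    (h : Dfn L v (fun t (γ : β ⊕ Unit → Γ) => P t (fun i => γ (Sum.inl i)) (γ (Sum.inr ())))) :
    Dfn L v (fun t γ => ∃ g, P t γ g) := by
  obtain ⟨φ, hφ⟩ := h
  have key : Dfn L v (fun (t : α ⊕ Unit → K) (γ : β → Γ) =>
      ∃ g : Γ, v (t (Sum.inr ())) = g ∧ P (fun i => t (Sum.inl i)) γ g) := by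
    -- A value is quantified through a field element having it. `φ` is uncontrolled at 0, whose
    -- value is `⊤`, so 0 is excluded.
    refine ⟨(φ.relabel (Sum.elim (Sum.inl ∘ Sum.inl) (Sum.elim Sum.inr
      (Sum.inl ∘ Sum.inr)))) ⊓ ∼(Term.equal (Term.var (Sum.inl (Sum.inr ())))
      (L.con (⟨0, trivial⟩ : (Set.univ : Set K))).term), fun t s γ hs => ?_⟩
    rw [Formula.realize_inf, Formula.realize_relabel, Formula.realize_not, Formula.realize_equal,
      Term.realize_con]
    have e : ∀ g : Γ, v (t (Sum.inr ())) = g →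
        (φ.Realize (Sum.elim t s ∘ Sum.elim (Sum.inl ∘ Sum.inl) (Sum.elim Sum.inr
          (Sum.inl ∘ Sum.inr))) ↔ P (fun i => t (Sum.inl i)) γ g) := by
      intro g hg
      have := hφ (fun i => t (Sum.inl i)) (Sum.elim s fun _ => t (Sum.inr ()))
        (Sum.elim γ fun _ => g) (by rintro (j | j); exacts [hs j, hg])
      refine Iff.trans (iff_of_eq ?_) this
      congr 1
      funext i
      rcases i with i | i | i <;> rfl
    constructor
    · rintro ⟨h1, h2⟩
      obtain ⟨g, hg⟩ := WithTop.ne_top_iff_exists.1 (v.ne_top_iff.2 h2)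
      exact ⟨g, hg.symm, (e g hg.symm).1 h1⟩
    · rintro ⟨g, hg, h⟩
      refine ⟨(e g hg).2 h, fun h0 => ?_⟩
      exact v.ne_top_iff.1 (hg ▸ WithTop.coe_ne_top) h0
  refine (ex (P := fun t γ x => ∃ g : Γ, v x = g ∧ P t γ g) key).congr fun t γ => ⟨fun ⟨_, g, _, h⟩ => ⟨g, h⟩, fun ⟨g, h⟩ => ?_⟩
  obtain ⟨x, hx⟩ := hv g
  exact ⟨x, g, hx, h⟩

theorem allVal (hv : Function.Surjective v) {P : (α → K) → (β → Γ) → Γ → Prop}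
    (h : Dfn L v (fun t (γ : β ⊕ Unit → Γ) => P t (fun i => γ (Sum.inl i)) (γ (Sum.inr ())))) :
    Dfn L v (fun t γ => ∀ g, P t γ g) :=
  (exVal hv (P := fun t γ x => ¬ P t γ x) h.not).not.congr fun t γ => by simp

theorem subst {P : (α' → K) → (β' → Γ) → Prop} (h : Dfn L v P) {a : α' → (α → K) → K}
    (ha : ∀ i, IsTermFun L (a i)) {k : β' → (β → Γ) → Γ} (hk : ∀ j, IsValTermFun L v (k j)) :
    Dfn L v (fun t γ => P (fun i => a i t) (fun j => k j γ)) := by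
  obtain ⟨φ, hφ⟩ := h
  choose τ hτ using ha
  choose σ hσ using hk
  refine ⟨BoundedFormula.subst φ (Sum.elim (fun i => (τ i).relabel Sum.inl)
    (fun j => (σ j).relabel Sum.inr)), fun t s γ hs => ?_⟩
  refine Iff.trans (iff_of_eq ?_)
    (hφ (fun i => a i t) (fun j => (σ j).realize s) _ fun j => hσ j s γ hs)
  rw [Formula.Realize, BoundedFormula.realize_subst]
  congr 1
  funext i
  rcases i with i | i
  · simp [Term.realize_relabel, hτ]
  · simp [Term.realize_relabel]

theorem eq {g g' : (α → K) → K} (h : IsTermFun L g) (h' : IsTermFun L g') :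
    Dfn L v (fun t (_ : β → Γ) => g t = g' t) := by
  obtain ⟨τ, hτ⟩ := h
  obtain ⟨τ', hτ'⟩ := h'
  refine ⟨Term.equal (τ.relabel Sum.inl) (τ'.relabel Sum.inl), fun t s γ hs => ?_⟩
  rw [Formula.realize_equal, Term.realize_relabel, Term.realize_relabel, Sum.elim_comp_inl, hτ,
    hτ']

theorem le {ι : Ldiv →ᴸ L} (hι : ι.reduct K = valuedFieldStructure v)
    {V V' : (α → K) → (β → Γ) → WithTop Γ} (h : IsValuedTerm L v V) (h' : IsValuedTerm L v V') :
    Dfn L v (fun t γ => V t γ ≤ V' t γ) := by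
  obtain ⟨τ, hτ⟩ := h
  obtain ⟨τ', hτ'⟩ := h'
  refine ⟨Relations.formula₂ (L := L[[(Set.univ : Set K)]])
    ((L.lhomWithConstants _).onRelation (ι.onRelation DivRel.div)) τ τ', fun t s γ hs => ?_⟩
  refine (realize_formula₂_onRelation hι _ τ τ' _).trans ?_
  change v _ ≤ v _ ↔ V t γ ≤ V' t γ
  rw [← hτ t s γ hs, ← hτ' t s γ hs]
  rfl

theorem lt {ι : Ldiv →ᴸ L} (hι : ι.reduct K = valuedFieldStructure v)
    {V V' : (α → K) → (β → Γ) → WithTop Γ} (h : IsValuedTerm L v V) (h' : IsValuedTerm L v V') :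
    Dfn L v (fun t γ => V t γ < V' t γ) :=
  (le hι h' h).not.congr fun _ _ => not_le

theorem valEq {ι : Ldiv →ᴸ L} (hι : ι.reduct K = valuedFieldStructure v)
    {V V' : (α → K) → (β → Γ) → WithTop Γ} (h : IsValuedTerm L v V) (h' : IsValuedTerm L v V') :
    Dfn L v (fun t γ => V t γ = V' t γ) :=
  ((le hι h h').and (le hι h' h)).congr fun _ _ => le_antisymm_iff.symm

theorem valLe {ι : Ldiv →ᴸ L} (hι : ι.reduct K = valuedFieldStructure v)
    {k k' : (β → Γ) → Γ} (h : IsValTermFun L v k) (h' : IsValTermFun L v k') :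
    Dfn L v (fun (_ : α → K) γ => k γ ≤ k' γ) :=
  (le hι h.isValuedTerm h'.isValuedTerm).congr fun _ _ => WithTop.coe_le_coe

theorem valLt {ι : Ldiv →ᴸ L} (hι : ι.reduct K = valuedFieldStructure v)
    {k k' : (β → Γ) → Γ} (h : IsValTermFun L v k) (h' : IsValTermFun L v k') :
    Dfn L v (fun (_ : α → K) γ => k γ < k' γ) :=
  (lt hι h.isValuedTerm h'.isValuedTerm).congr fun _ _ => WithTop.coe_lt_coe

theorem of_definable {S : Set (α → K)} (h : (Set.univ : Set K).Definable L S) :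
    Dfn L v (fun t (_ : β → Γ) => t ∈ S) := by
  obtain ⟨φ, rfl⟩ := h
  refine ⟨φ.relabel Sum.inl, fun t s γ hs => ?_⟩
  rw [Formula.realize_relabel, Sum.elim_comp_inl]
  rfl

theorem definable {P : (α → K) → (Empty → Γ) → Prop} (h : Dfn L v P) :
    (Set.univ : Set K).Definable L {t | P t Empty.elim} := by
  obtain ⟨φ, hφ⟩ := h
  refine ⟨φ.relabel (Sum.elim id Empty.elim), ?_⟩
  ext t
  have := hφ t Empty.elim Empty.elim fun j => j.elim
  rw [Set.mem_ofPred_eq, Set.mem_ofPred_eq, ← this, Formula.realize_relabel]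
  apply iff_of_eq
  congr 1
  funext i
  rcases i with i | i
  · rfl
  · exact i.elim

theorem definableVal [Finite β] {S : Set ((α → K) × (β → Γ))}
    (h : Dfn L v (fun t γ => (t, γ) ∈ S)) : DefinableVal L v S := by
  obtain ⟨φ, hφ⟩ := h
  have h0 : (Set.univ : Set K).Definable L {t : α ⊕ β → K | ∀ j, t (Sum.inr j) ≠ 0} := by
    have := Fintype.ofFinite β
    have : {t : α ⊕ β → K | ∀ j, t (Sum.inr j) ≠ 0} =
        ⋂ j ∈ (Finset.univ : Finset β), {t : α ⊕ β → K | t (Sum.inr j) ≠ 0} := by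
      ext t; simp
    rw [this]
    refine Set.definable_biInter_finset (fun j => ?_) _
    refine ⟨∼(Term.equal (Term.var (Sum.inr j))
      (L.con (⟨0, trivial⟩ : (Set.univ : Set K))).term), ?_⟩
    ext t
    rw [Set.mem_ofPred_eq, Set.mem_ofPred_eq, Formula.realize_not, Formula.realize_equal,
      Term.realize_con]
    rfl
  have h1 : (Set.univ : Set K).Definable L (Set.ofPred φ.Realize) := ⟨φ, rfl⟩
  unfold DefinableVal
  convert h0.inter h1 using 1
  ext t
  have e : ∀ γ : β → Γ, (∀ j, v (t (Sum.inr j)) = γ j) →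
      (φ.Realize t ↔ (fun i => t (Sum.inl i), γ) ∈ S) := fun γ hγ => by
    refine Iff.trans (iff_of_eq ?_) (hφ _ (fun j => t (Sum.inr j)) γ hγ)
    congr 1
    funext i
    rcases i with i | i <;> rfl
  constructor
  · rintro ⟨γ, hγ, hS⟩
    refine ⟨fun j hj => ?_, (e γ hγ).2 hS⟩
    exact v.ne_top_iff.1 (hγ j ▸ WithTop.coe_ne_top) hj
  · rintro ⟨h0, h1⟩
    choose γ hγ using fun j => WithTop.ne_top_iff_exists.1 (v.ne_top_iff.2 (h0 j))
    exact ⟨γ, fun j => (hγ j).symm, (e γ fun j => (hγ j).symm).1 h1⟩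

end Dfn

end

/-! ### Tame subsets of a dense linear order -/

section

variable {Γ : Type*} [LinearOrder Γ]

/-- `S` is constant on the intervals which avoid some finite set. -/
def IsTame (S : Set Γ) : Prop :=
  ∃ E : Set Γ, E.Finite ∧ ∀ γ γ', γ ≤ γ' → (∀ e ∈ E, γ ≤ e → γ' < e) → (γ ∈ S ↔ γ' ∈ S)

theorem exists_gt_avoiding [NoMaxOrder Γ] [DenselyOrdered Γ] {E : Set Γ} (hE : E.Finite) (a : Γ) :
    ∃ b > a, ∀ e ∈ E, a < e → b < e := by
  induction E, hE using Set.Finite.induction_on with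
  | empty => exact (exists_gt a).imp fun b hb => ⟨hb, by simp⟩
  | @insert e E _ _ ih =>
    obtain ⟨b, hb, h⟩ := ih
    by_cases hae : a < e
    · obtain ⟨c, hc, hc'⟩ := exists_between (lt_min hb hae)
      refine ⟨c, hc, ?_⟩
      rintro e' (rfl | he') h'
      · exact hc'.trans_le (min_le_right _ _)
      · exact (hc'.trans_le (min_le_left _ _)).trans (h e' he' h')
    · refine ⟨b, hb, ?_⟩
      rintro e' (rfl | he') h'
      · exact absurd h' hae
      · exact h e' he' h'

theorem exists_lt_avoiding [NoMinOrder Γ] [DenselyOrdered Γ] {E : Set Γ} (hE : E.Finite) (a : Γ) :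
    ∃ b < a, ∀ e ∈ E, e < a → e < b :=
  exists_gt_avoiding (Γ := Γᵒᵈ) hE a

namespace IsTame

theorem exists_right_germ [NoMaxOrder Γ] [DenselyOrdered Γ] {S : Set Γ} (hS : IsTame S) (a : Γ) :
    ∃ b > a, (∀ c, a < c → c < b → c ∈ S) ∨ (∀ c, a < c → c < b → c ∉ S) := by
  obtain ⟨E, hE, h⟩ := hS
  obtain ⟨b, hb, h'⟩ := exists_gt_avoiding hE a
  refine ⟨b, hb, ?_⟩
  have : ∀ c, a < c → c < b → (c ∈ S ↔ b ∈ S) := fun c hc hcb =>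
    h c b hcb.le fun e he hce => h' e he (hc.trans_le hce)
  by_cases hbS : b ∈ S
  · exact Or.inl fun c h1 h2 => (this c h1 h2).2 hbS
  · exact Or.inr fun c h1 h2 => mt (this c h1 h2).1 hbS

/-- Order completeness is not available: an infimum that is not attained is found among the finitely
many breakpoints and the given lower bound. -/
theorem exists_isGLB [DenselyOrdered Γ] {S : Set Γ} (hS : IsTame S) (hne : S.Nonempty)
    (hbd : BddBelow S) : ∃ e, IsGLB S e := by
  by_cases hmin : ∃ s ∈ S, s ∈ lowerBounds S
  · obtain ⟨s, hs, hs'⟩ := hmin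
    exact ⟨s, hs', fun m hm => hm hs⟩
  push Not at hmin
  obtain ⟨E, hE, h⟩ := hS
  obtain ⟨s, hs⟩ := hne
  obtain ⟨l, hl⟩ := hbd
  -- No breakpoint lies strictly between `m` and `n` below, so `S` is constant there; a lower bound
  -- above `m` would then have elements of `S` beneath it.
  obtain ⟨m, ⟨hmE, hm⟩, hmax⟩ := Set.exists_max_image ((insert l E) ∩ lowerBounds S) id
    ((hE.insert l).subset Set.inter_subset_left) ⟨l, Set.mem_insert _ _, hl⟩
  obtain ⟨n, ⟨hnE, hn⟩, hnmin⟩ := Set.exists_min_image ((insert s E) \ lowerBounds S) id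
    ((hE.insert s).subset Set.sdiff_subset) ⟨s, Set.mem_insert _ _, hmin s hs⟩
  refine ⟨m, hm, fun m' hm' => ?_⟩
  by_contra! hlt
  obtain ⟨u, hu, hu'⟩ := exists_between hlt
  have : ∃ s₂ ∈ S, s₂ < n := by
    by_contra! h'
    exact hn h'
  obtain ⟨s₂, hs₂, hsn⟩ := this
  have hus : u < s₂ := hu'.trans_le (hm' hs₂)
  have huS : u ∈ S := by
    refine (h u s₂ hus.le fun e he hue => ?_).2 hs₂
    by_cases hel : e ∈ lowerBounds S
    · exact absurd (hmax e ⟨Or.inr he, hel⟩) (hu.trans_le hue).not_ge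
    · exact hsn.trans_le (hnmin e ⟨Or.inr he, hel⟩)
  exact (hm' huS).not_gt hu'

end IsTame

end

/-! ### Definable subsets of the field -/

/-- `IsCMinimal` speaks of models in a larger universe, so it is applied to the isomorphic lift of
`K` and the balls are transported back. -/
theorem IsCMinimal.induction {L : FirstOrder.Language.{u₁, u₂}} [L.Structure K]
    {v : AddValuation K (WithTop Γ)} {ι : Ldiv →ᴸ L}
    (hι : ι.reduct K = valuedFieldStructure v) (hK : IsCMinimal ι K) {p : Set K → Prop}
    (univ : p Set.univ) (closedBall : ∀ a c : K, p {x | v c ≤ v (x - a)})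
    (openBall : ∀ a c : K, p {x | v c < v (x - a)})
    (union : ∀ X Y, p X → p Y → p (X ∪ Y)) (compl : ∀ X, p X → p Xᶜ) {X : Set K}
    (hX : (Set.univ : Set K).Definable₁ L X) : p X := by
  let e : K ≃ ULift.{max u₁ u₂} K := Equiv.ulift.symm
  let _ : L.Structure (ULift.{max u₁ u₂} K) := e.inducedStructure
  let E : L.Equiv K (ULift.{max u₁ u₂} K) := e.inducedStructureEquiv
  have hdiv : ∀ x y : ULift.{max u₁ u₂} K,
      @div _ (ι.reduct (ULift.{max u₁ u₂} K)) x y ↔ v x.down ≤ v y.down := by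
    intro x y
    have h : @div _ (ι.reduct (ULift.{max u₁ u₂} K)) x y ↔
      (ι.reduct K).RelMap DivRel.div (e.symm ∘ ![x, y]) := Iff.rfl
    rw [h, hι]
    rfl
  have hsub : ∀ x y : ULift.{max u₁ u₂} K,
      (@sub _ (ι.reduct (ULift.{max u₁ u₂} K)) x y).down = x.down - y.down := by
    intro x y
    have h : (@sub _ (ι.reduct (ULift.{max u₁ u₂} K)) x y).down =
      (ι.reduct K).funMap ringFunc.add (e.symm ∘ ![x, e ((ι.reduct K).funMap ringFunc.neg
        (e.symm ∘ ![y]))]) := rfl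
    rw [h, hι, sub_eq_add_neg]
    rfl
  have hX' : (Set.univ : Set (ULift.{max u₁ u₂} K)).Definable₁ L (ULift.down ⁻¹' X) := by
    obtain ⟨φ, hφ⟩ := Set.definable_iff_exists_formula_sum.1 hX
    refine Set.definable_iff_exists_formula_sum.2
      ⟨φ.relabel (Sum.map (fun a => ⟨e a.1, trivial⟩) id), ?_⟩
    ext t
    have h1 := Set.ext_iff.1 hφ (fun i => (t i).down)
    refine h1.trans ?_
    rw [Set.mem_ofPred_eq, Set.mem_ofPred_eq, Formula.realize_relabel,
      ← StrongHomClass.realize_formula E]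
    apply iff_of_eq
    congr 1
    funext i
    rcases i with i | i <;> rfl
  have key := hK (ULift.{max u₁ u₂} K) (StrongHomClass.elementarilyEquivalent E) _ hX'
  have := BooleanSubalgebra.closure_bot_sup_induction
    (p := fun S _ => p (ULift.up ⁻¹' S)) ?_ ?_ ?_ ?_ key
  · exact this
  · rintro S (rfl | ⟨a, c, rfl⟩ | ⟨a, c, rfl⟩)
    · exact univ
    · convert closedBall a.down c.down using 1
      ext x
      exact (hdiv _ _).trans (by rw [hsub]; rfl)
    · convert openBall a.down c.down using 1
      ext x
      exact (not_congr (hdiv _ _)).trans (by rw [hsub, not_le]; rfl)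
  · have := compl _ univ
    rwa [Set.compl_univ] at this
  · exact fun S _ T _ hS hT => union _ _ hS hT
  · exact fun S _ hS => compl _ hS

/-- Balls are clopen apart from the degenerate closed balls, whose single point is the only
exception. In particular an infinite definable set contains an open ball. -/
theorem exists_finset_locally_constant {L : FirstOrder.Language.{u₁, u₂}} [L.Structure K]
    {v : AddValuation K (WithTop Γ)} {ι : Ldiv →ᴸ L}
    (hι : ι.reduct K = valuedFieldStructure v) (hK : IsCMinimal ι K) {X : Set K}
    (hX : (Set.univ : Set K).Definable₁ L X) :
    ∃ E : Set K, E.Finite ∧ ∀ x ∉ E, ∃ ρ : Γ, ∀ y, (ρ : WithTop Γ) < v (y - x) →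
      (y ∈ X ↔ x ∈ X) := by
  have hball : ∀ a c x y : K, v c < v (y - x) →
      (v c ≤ v (x - a) ↔ v c ≤ v (y - a)) ∧ (v c < v (x - a) ↔ v c < v (y - a)) := by
    intro a c x y h
    have h1 : y - a = (y - x) + (x - a) := by ring
    have h2 : x - a = (y - a) - (y - x) := by ring
    refine ⟨⟨fun h' => h1 ▸ v.map_le_add h.le h', fun h' => h2 ▸ v.map_le_sub h' h.le⟩,
      fun h' => h1 ▸ v.map_lt_add h h', fun h' => ?_⟩
    rw [h2, sub_eq_add_neg]
    exact v.map_lt_add h' (by rwa [v.map_neg])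
  refine hK.induction hι (p := fun X => ∃ E : Set K, E.Finite ∧ ∀ x ∉ E, ∃ ρ : Γ, ∀ y,
    (ρ : WithTop Γ) < v (y - x) → (y ∈ X ↔ x ∈ X)) ?_ ?_ ?_ ?_ ?_ hX
  · exact ⟨∅, Set.finite_empty, fun x _ => ⟨0, fun y _ => by simp⟩⟩
  · intro a c
    refine ⟨{a}, Set.finite_singleton a, fun x hx => ?_⟩
    by_cases hc : c = 0
    · subst hc
      have hxa : x - a ≠ 0 := sub_ne_zero.2 hx
      obtain ⟨ρ, hρ⟩ := WithTop.ne_top_iff_exists.1 (v.ne_top_iff.2 hxa)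
      refine ⟨ρ, fun y hy => ?_⟩
      simp only [Set.mem_ofPred_eq, v.map_zero, top_le_iff, v.top_iff, hxa, iff_false]
      intro h
      rw [sub_eq_zero.1 h, v.map_sub_swap, hρ] at hy
      exact hy.false
    · obtain ⟨ρ, hρ⟩ := WithTop.ne_top_iff_exists.1 (v.ne_top_iff.2 hc)
      exact ⟨ρ, fun y hy => (hball a c x y (hρ ▸ hy)).1.symm⟩
  · intro a c
    refine ⟨∅, Set.finite_empty, fun x _ => ?_⟩
    by_cases hc : c = 0
    · subst hc
      exact ⟨0, fun y _ => by simp⟩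
    · obtain ⟨ρ, hρ⟩ := WithTop.ne_top_iff_exists.1 (v.ne_top_iff.2 hc)
      exact ⟨ρ, fun y hy => (hball a c x y (hρ ▸ hy)).2.symm⟩
  · rintro X Y ⟨E, hE, h⟩ ⟨E', hE', h'⟩
    refine ⟨E ∪ E', hE.union hE', fun x hx => ?_⟩
    obtain ⟨ρ, hρ⟩ := h x fun hx' => hx (Or.inl hx')
    obtain ⟨ρ', hρ'⟩ := h' x fun hx' => hx (Or.inr hx')
    refine ⟨max ρ ρ', fun y hy => or_congr (hρ y ?_) (hρ' y ?_)⟩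
    · exact (WithTop.coe_le_coe.2 (le_max_left _ _)).trans_lt hy
    · exact (WithTop.coe_le_coe.2 (le_max_right _ _)).trans_lt hy
  · rintro X ⟨E, hE, h⟩
    refine ⟨E, hE, fun x hx => ?_⟩
    obtain ⟨ρ, hρ⟩ := h x hx
    exact ⟨ρ, fun y hy => not_congr (hρ y hy)⟩

/-! ### Definable subsets of the value group -/

/-- C-minimality applies to the preimage of `S` under `v`. For a ball about `a` of radius `v c`,
membership of a nonzero x does not change while `v x` runs through an interval avoiding `v a` and `v
c`. -/
theorem isTame_of_dfn {L : FirstOrder.Language.{u₁, u₂}} [L.Structure K]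
    {v : AddValuation K (WithTop Γ)} (hv : Function.Surjective v) {ι : Ldiv →ᴸ L}
    (hι : ι.reduct K = valuedFieldStructure v) (hK : IsCMinimal ι K) {S : Set Γ}
    (hS : Dfn L v (fun (_ : Empty → K) (γ : Fin 1 → Γ) => γ 0 ∈ S)) : IsTame S := by
  have hX : (Set.univ : Set K).Definable₁ L {x | ∃ γ : Γ, v x = γ ∧ γ ∈ S} := by
    have : Dfn L v (fun (t : Fin 1 → K) (_ : Empty → Γ) => ∃ γ : Γ, v (t 0) = γ ∧ γ ∈ S) := by
      refine Dfn.exVal hv (Dfn.and (Dfn.valEq hι ?_ ?_) ?_)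
      · exact (isTermFun_var 0).isValuedTerm
      · exact (isValTermFun_var _).isValuedTerm
      · exact hS.subst (a := fun i => i.elim) (fun i => i.elim)
          (k := fun _ γ => γ (Sum.inr ())) (fun _ => isValTermFun_var _)
    exact this.definable
  have key : ∃ E : Set Γ, E.Finite ∧ ∀ x y : K, v x ≤ v y → x ≠ 0 → y ≠ 0 →
      (∀ e ∈ E, v x ≤ (e : WithTop Γ) → v y < (e : WithTop Γ)) →
      (x ∈ {x | ∃ γ : Γ, v x = γ ∧ γ ∈ S} ↔ y ∈ {x | ∃ γ : Γ, v x = γ ∧ γ ∈ S}) := by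
    have balls : ∀ a : K, ∃ E : Set Γ, E.Finite ∧ ∀ (x y c : K), c ≠ 0 → v x ≤ v y →
        y ≠ 0 → (∀ e ∈ E, v x ≤ (e : WithTop Γ) → v y < (e : WithTop Γ)) →
        (v x ≤ v c → v y < v c) → v (x - a) = v (y - a) ∨
          (v c < v (x - a) ∧ v c < v (y - a)) ∨ (v (x - a) < v c ∧ v (y - a) < v c) := by
      intro a
      by_cases ha : a = 0
      · subst ha
        refine ⟨∅, Set.finite_empty, fun x y c hc hxy hy _ h => ?_⟩
        rw [sub_zero, sub_zero]
        by_cases hxc : v x ≤ v c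
        · exact Or.inr (Or.inr ⟨hxy.trans_lt (h hxc), h hxc⟩)
        · exact Or.inr (Or.inl ⟨not_le.1 hxc, (not_le.1 hxc).trans_le hxy⟩)
      · obtain ⟨α, hα⟩ := WithTop.ne_top_iff_exists.1 (v.ne_top_iff.2 ha)
        refine ⟨{α}, Set.finite_singleton α, fun x y c hc hxy hy h h' => ?_⟩
        have h := h α rfl
        rw [hα] at h
        by_cases hxa : v x ≤ v a
        · have hya := h hxa
          have hxa' := hxy.trans_lt hya
          rw [v.map_sub_eq_of_lt_left hxa', v.map_sub_eq_of_lt_left hya]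
          by_cases hxc : v x ≤ v c
          · exact Or.inr (Or.inr ⟨hxy.trans_lt (h' hxc), h' hxc⟩)
          · exact Or.inr (Or.inl ⟨not_le.1 hxc, (not_le.1 hxc).trans_le hxy⟩)
        · have hax := not_le.1 hxa
          rw [v.map_sub_eq_of_lt_right hax, v.map_sub_eq_of_lt_right (hax.trans_le hxy)]
          exact Or.inl rfl
    refine hK.induction hι (p := fun X => ∃ E : Set Γ, E.Finite ∧ ∀ x y : K, v x ≤ v y →
      x ≠ 0 → y ≠ 0 → (∀ e ∈ E, v x ≤ (e : WithTop Γ) → v y < (e : WithTop Γ)) →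
      (x ∈ X ↔ y ∈ X)) ?_ ?_ ?_ ?_ ?_ hX
    · exact ⟨∅, Set.finite_empty, fun x y _ _ _ _ => by simp⟩
    · intro a c
      obtain ⟨E, hE, h⟩ := balls a
      by_cases hc : c = 0
      · by_cases ha : a = 0
        · subst ha hc
          exact ⟨∅, Set.finite_empty, fun x y _ hx hy _ => by simp [hx, hy]⟩
        · obtain ⟨α, hα⟩ := WithTop.ne_top_iff_exists.1 (v.ne_top_iff.2 ha)
          refine ⟨{α}, Set.finite_singleton α, fun x y hxy _ _ h => ?_⟩
          have h1 := h α rfl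
          subst hc
          simp only [Set.mem_ofPred_eq, v.map_zero, top_le_iff, v.top_iff, sub_eq_zero]
          constructor
          · rintro rfl
            rw [hα] at h1
            exact absurd (h1 le_rfl) hxy.not_gt
          · rintro rfl
            rw [hα] at h1
            exact absurd (h1 hxy) (lt_irrefl _)
      · obtain ⟨ρ, hρ⟩ := WithTop.ne_top_iff_exists.1 (v.ne_top_iff.2 hc)
        refine ⟨insert ρ E, hE.insert ρ, fun x y hxy _ hy h' => ?_⟩
        have h1 := h' ρ (Set.mem_insert _ _)
        rw [hρ] at h1
        rcases h x y c hc hxy hy (fun e he => h' e (Or.inr he)) h1 with h2 | ⟨h2, h3⟩ | ⟨h2, h3⟩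
        · simp [h2]
        · simp [h2.le, h3.le]
        · simp [h2.not_ge, h3.not_ge]
    · intro a c
      obtain ⟨E, hE, h⟩ := balls a
      by_cases hc : c = 0
      · subst hc
        exact ⟨∅, Set.finite_empty, fun x y _ _ _ _ => by simp⟩
      · obtain ⟨ρ, hρ⟩ := WithTop.ne_top_iff_exists.1 (v.ne_top_iff.2 hc)
        refine ⟨insert ρ E, hE.insert ρ, fun x y hxy _ hy h' => ?_⟩
        have h1 := h' ρ (Set.mem_insert _ _)
        rw [hρ] at h1
        rcases h x y c hc hxy hy (fun e he => h' e (Or.inr he)) h1 with h2 | ⟨h2, h3⟩ | ⟨h2, h3⟩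
        · simp [h2]
        · simp [h2, h3]
        · simp [h2.not_gt, h3.not_gt]
    · rintro X Y ⟨E, hE, h⟩ ⟨E', hE', h'⟩
      refine ⟨E ∪ E', hE.union hE', fun x y hxy hx hy he => or_congr ?_ ?_⟩
      · exact h x y hxy hx hy fun e h => he e (Or.inl h)
      · exact h' x y hxy hx hy fun e h => he e (Or.inr h)
    · rintro X ⟨E, hE, h⟩
      exact ⟨E, hE, fun x y hxy hx hy he => not_congr (h x y hxy hx hy he)⟩
  obtain ⟨E, hE, h⟩ := key
  refine ⟨E, hE, fun γ γ' hle he => ?_⟩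
  obtain ⟨x, hx⟩ := hv γ
  obtain ⟨y, hy⟩ := hv γ'
  have := h x y (by rw [hx, hy]; exact_mod_cast hle)
    (v.ne_top_iff.1 (hx ▸ WithTop.coe_ne_top)) (v.ne_top_iff.1 (hy ▸ WithTop.coe_ne_top))
    (by rw [hx, hy]; exact_mod_cast he)
  simpa [hx, hy, WithTop.coe_inj] using this

/-! ### Thin sets: finitely many residue classes in a closed ball -/

/-- `Z` is covered by finitely many open balls of radius `δ`. -/
def Thin (v : AddValuation K (WithTop Γ)) (δ : Γ) (Z : Set K) : Prop :=
  ∃ E : Set K, E.Finite ∧ ∀ x ∈ Z, ∃ e ∈ E, (δ : WithTop Γ) < v (x - e)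

theorem lt_val_sub_trans {v : AddValuation K (WithTop Γ)} {δ : WithTop Γ} {x y z : K}
    (h : δ < v (x - y)) (h' : δ < v (y - z)) : δ < v (x - z) := by
  have e : x - z = (x - y) + (y - z) := by ring
  exact e ▸ v.map_lt_add h h'

theorem le_val_sub_trans {v : AddValuation K (WithTop Γ)} {δ : WithTop Γ} {x y z : K}
    (h : δ ≤ v (x - y)) (h' : δ ≤ v (y - z)) : δ ≤ v (x - z) := by
  have e : x - z = (x - y) + (y - z) := by ring
  exact e ▸ v.map_le_add h h'

namespace Thin

variable {v : AddValuation K (WithTop Γ)} {δ : Γ}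

theorem mono {Z Z' : Set K} (h : Thin v δ Z) (hZ : Z' ⊆ Z) : Thin v δ Z' :=
  let ⟨E, hE, h⟩ := h
  ⟨E, hE, fun x hx => h x (hZ hx)⟩

theorem empty : Thin v δ ∅ := ⟨∅, Set.finite_empty, fun _ h => h.elim⟩

theorem union {Z Z' : Set K} (h : Thin v δ Z) (h' : Thin v δ Z') : Thin v δ (Z ∪ Z') := by
  obtain ⟨E, hE, h⟩ := h
  obtain ⟨E', hE', h'⟩ := h'
  refine ⟨E ∪ E', hE.union hE', ?_⟩
  rintro x (hx | hx)
  · obtain ⟨e, he, hxe⟩ := h x hx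
    exact ⟨e, Or.inl he, hxe⟩
  · obtain ⟨e, he, hxe⟩ := h' x hx
    exact ⟨e, Or.inr he, hxe⟩

theorem biUnion {ι : Type*} {s : Set ι} (hs : s.Finite) {Z : ι → Set K}
    (h : ∀ i ∈ s, Thin v δ (Z i)) : Thin v δ (⋃ i ∈ s, Z i) := by
  choose! E hE h using h
  refine ⟨⋃ i ∈ s, E i, hs.biUnion hE, fun x hx => ?_⟩
  obtain ⟨i, hi, hx⟩ := Set.mem_iUnion₂.1 hx
  obtain ⟨e, he, hxe⟩ := h i hi x hx
  exact ⟨e, Set.mem_iUnion₂.2 ⟨i, hi, he⟩, hxe⟩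

end Thin

/-- Strong minimality of the residue field: a large ball contains the closed ball or misses it, and
a small one meets at most one residue class. -/
theorem thin_inter_or_thin_diff {L : FirstOrder.Language.{u₁, u₂}} [L.Structure K]
    {v : AddValuation K (WithTop Γ)} {ι : Ldiv →ᴸ L}
    (hι : ι.reduct K = valuedFieldStructure v) (hK : IsCMinimal ι K) {X : Set K}
    (hX : (Set.univ : Set K).Definable₁ L X) (a : K) (δ : Γ) :
    Thin v δ (X ∩ {x | (δ : WithTop Γ) ≤ v (x - a)}) ∨
      Thin v δ ({x | (δ : WithTop Γ) ≤ v (x - a)} \ X) := by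
  have dichotomy : ∀ Z : Set K, (∀ x ∈ Z, ∀ y, (δ : WithTop Γ) ≤ v (y - x) → y ∈ Z) →
      Thin v δ (Z ∩ {x | (δ : WithTop Γ) ≤ v (x - a)}) ∨
        Thin v δ ({x | (δ : WithTop Γ) ≤ v (x - a)} \ Z) := by
    intro Z hZ
    by_cases h : ∃ x ∈ Z, (δ : WithTop Γ) ≤ v (x - a)
    · obtain ⟨x, hxZ, hx⟩ := h
      refine Or.inr (Thin.empty.mono fun y hy => hy.2 (hZ x hxZ y ?_))
      rw [v.map_sub_swap] at hx
      exact le_val_sub_trans hy.1 hx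
    · exact Or.inl (Thin.empty.mono fun y hy => h ⟨y, hy⟩)
  refine hK.induction hι (p := fun X => Thin v δ (X ∩ {x | (δ : WithTop Γ) ≤ v (x - a)}) ∨
    Thin v δ ({x | (δ : WithTop Γ) ≤ v (x - a)} \ X)) ?_ ?_ ?_ ?_ ?_ hX
  · exact dichotomy _ fun _ _ _ _ => trivial
  · intro b c
    by_cases hc : v c ≤ δ
    · exact dichotomy _ fun x hx y hy => le_val_sub_trans (hc.trans hy) hx
    · exact Or.inl ⟨{b}, Set.finite_singleton b, fun x hx =>
        ⟨b, rfl, (not_le.1 hc).trans_le hx.1⟩⟩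
  · intro b c
    by_cases hc : v c < δ
    · exact dichotomy _ fun x hx y hy => lt_val_sub_trans (hc.trans_le hy) hx
    · exact Or.inl ⟨{b}, Set.finite_singleton b, fun x hx =>
        ⟨b, rfl, (not_lt.1 hc).trans_lt hx.1⟩⟩
  · rintro X Y (hX | hX) (hY | hY)
    · exact Or.inl ((hX.union hY).mono fun x hx => hx.1.imp (⟨·, hx.2⟩) (⟨·, hx.2⟩))
    · exact Or.inr (hY.mono fun x hx => ⟨hx.1, fun h => hx.2 (Or.inr h)⟩)
    · exact Or.inr (hX.mono fun x hx => ⟨hx.1, fun h => hx.2 (Or.inl h)⟩)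
    · exact Or.inr (hX.mono fun x hx => ⟨hx.1, fun h => hx.2 (Or.inl h)⟩)
  · rintro X (hX | hX)
    · exact Or.inr (hX.mono fun x hx => ⟨by simpa using hx.2, hx.1⟩)
    · exact Or.inl (hX.mono fun x hx => ⟨hx.2, hx.1⟩)

/-! ### Density of the value group and infinitude of the residue field -/

theorem exists_half [IsAlgClosed K] {v : AddValuation K (WithTop Γ)}
    (hv : Function.Surjective v) (γ : Γ) : ∃ η : Γ, η + η = γ := by
  obtain ⟨c, hc⟩ := hv γ
  obtain ⟨x, rfl⟩ := IsAlgClosed.exists_pow_nat_eq c (n := 2) two_pos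
  rw [v.map_pow, two_nsmul] at hc
  have hx : v x ≠ ⊤ := fun h => by simp [h] at hc
  obtain ⟨η, hη⟩ := WithTop.ne_top_iff_exists.1 hx
  rw [← hη, ← WithTop.coe_add] at hc
  exact ⟨η, WithTop.coe_inj.1 hc⟩

theorem denselyOrdered_of_isAlgClosed [IsAlgClosed K] {v : AddValuation K (WithTop Γ)}
    (hv : Function.Surjective v) : DenselyOrdered Γ where
  dense a b hab := by
    obtain ⟨η, hη⟩ := exists_half hv (a + b)
    refine ⟨η, lt_of_not_ge fun h => ?_, lt_of_not_ge fun h => ?_⟩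
    · exact ((add_le_add h h).trans_lt (add_lt_add_right hab a)).ne hη
    · exact ((add_lt_add_left hab b).trans_le (add_le_add h h)).ne' hη

theorem val_prod_sub {v : AddValuation K (WithTop Γ)} (E : Finset K) (x : K) (g : K → Γ)
    (hg : ∀ e ∈ E, v (x - e) = g e) : v (∏ e ∈ E, (x - e)) = ((∑ e ∈ E, g e : Γ) : WithTop Γ) := by
  classical
  induction E using Finset.induction_on with
  | empty => simp
  | insert e E he ih =>
    rw [Finset.prod_insert he, Finset.sum_insert he, v.map_mul, hg e (Finset.mem_insert_self _ _),
      ih fun e' he' => hg e' (Finset.mem_insert_of_mem he'), WithTop.coe_add]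

/-- Let `E` be finitely many centres covering the ball, and let x solve ∏(x - e) = c^|E| with v(c) =
δ. The values v(x - e) sum to |E|δ. If x is in the ball, all are at least δ and one is larger;
otherwise all are smaller. -/
theorem not_thin_closedBall [IsAlgClosed K] {v : AddValuation K (WithTop Γ)}
    (hv : Function.Surjective v) (a : K) (δ : Γ) :
    ¬ Thin v δ {x | (δ : WithTop Γ) ≤ v (x - a)} := by
  rintro ⟨E₀, hE₀, h⟩
  classical
  obtain ⟨c, hc⟩ := hv δ
  have hc0 : c ≠ 0 := v.ne_top_iff.1 (hc ▸ WithTop.coe_ne_top)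
  -- Centres outside the closed ball cover nothing in it; the remaining ones are pairwise at
  -- distance at least δ in value.
  set E : Finset K := hE₀.toFinset.filter (fun e => (δ : WithTop Γ) ≤ v (e - a)) with hE
  have hcover : ∀ x, (δ : WithTop Γ) ≤ v (x - a) → ∃ e ∈ E, (δ : WithTop Γ) < v (x - e) := by
    intro x hx
    obtain ⟨e, he, hxe⟩ := h x hx
    refine ⟨e, ?_, hxe⟩
    rw [hE, Finset.mem_filter, hE₀.mem_toFinset]
    refine ⟨he, ?_⟩
    rw [v.map_sub_swap] at hxe
    exact le_val_sub_trans hxe.le hx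
  have hEa : ∀ e ∈ E, (δ : WithTop Γ) ≤ v (e - a) := fun e he => (Finset.mem_filter.1 he).2
  have hne : E.Nonempty := by
    obtain ⟨e, he, -⟩ := hcover a (by simp)
    exact ⟨e, he⟩
  obtain ⟨x, hx⟩ : ∃ x : K, ∏ e ∈ E, (x - e) = c ^ E.card := by
    have hdeg : (∏ e ∈ E, (Polynomial.X - Polynomial.C e)).natDegree = E.card := by
      simp
    have hdeg' : (∏ e ∈ E, (Polynomial.X - Polynomial.C e) -
        Polynomial.C (c ^ E.card)).degree ≠ 0 := by
      have h1 : (∏ e ∈ E, (Polynomial.X - Polynomial.C e) -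
        Polynomial.C (c ^ E.card)).natDegree = E.card := by
        rw [Polynomial.natDegree_sub_C, hdeg]
      intro h0
      rw [Polynomial.natDegree_eq_of_degree_eq_some h0] at h1
      exact hne.card_pos.ne h1
    obtain ⟨x, hx⟩ := IsAlgClosed.exists_root _ hdeg'
    refine ⟨x, ?_⟩
    rw [Polynomial.IsRoot, Polynomial.eval_sub, Polynomial.eval_prod, Polynomial.eval_C] at hx
    simpa using sub_eq_zero.1 hx
  have hx0 : ∀ e ∈ E, v (x - e) ≠ ⊤ := fun e he h0 => by
    rw [Finset.prod_eq_zero he (v.top_iff.1 h0)] at hx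
    exact pow_ne_zero _ hc0 hx.symm
  choose! g hg using fun e he => WithTop.ne_top_iff_exists.1 (hx0 e he)
  have hsum : ∑ e ∈ E, g e = ∑ _e ∈ E, δ := by
    have h1 := val_prod_sub E x g fun e he => (hg e he).symm
    rw [hx, v.map_pow, hc] at h1
    rw [Finset.sum_const]
    exact_mod_cast h1.symm
  have hEE : ∀ e ∈ E, ∀ e' ∈ E, (δ : WithTop Γ) ≤ v (e - e') := fun e he e' he' => by
    have := hEa e' he'
    rw [v.map_sub_swap] at this
    exact le_val_sub_trans (hEa e he) this
  by_cases hxD : ∃ e ∈ E, (δ : WithTop Γ) ≤ v (x - e)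
  · obtain ⟨e, he, hxe⟩ := hxD
    obtain ⟨e', he', hxe'⟩ := hcover x (le_val_sub_trans hxe (hEa e he))
    refine (Finset.sum_lt_sum (fun i hi => ?_) ⟨e', he', ?_⟩).ne hsum.symm
    · have := le_val_sub_trans hxe (hEE e he i hi)
      rw [← hg i hi] at this
      exact WithTop.coe_le_coe.1 this
    · rw [← hg e' he'] at hxe'
      exact WithTop.coe_lt_coe.1 hxe'
  · push Not at hxD
    refine (Finset.sum_lt_sum_of_nonempty hne fun i hi => ?_).ne hsum
    have := hxD i hi
    rw [← hg i hi] at this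
    exact WithTop.coe_lt_coe.1 this

/-! ### Orthogonality of the residue field and the value group -/

namespace Dfn

variable {L : FirstOrder.Language.{u₁, u₂}} [L.Structure K] {v : AddValuation K (WithTop Γ)}
  {α β : Type}

theorem app {R : K → Γ → Prop}
    (h : Dfn L v (fun (t : Fin 1 → K) (γ : Fin 1 → Γ) => R (t 0) (γ 0))) {a : (α → K) → K}
    (ha : IsTermFun L a) {k : (β → Γ) → Γ} (hk : IsValTermFun L v k) :
    Dfn L v (fun t γ => R (a t) (k γ)) :=
  h.subst (a := fun _ => a) (fun _ => ha) (k := fun _ => k) (fun _ => hk)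

theorem isGLB (hv : Function.Surjective v) {ι : Ldiv →ᴸ L}
    (hι : ι.reduct K = valuedFieldStructure v) {S : K → Γ → Prop}
    (h : Dfn L v (fun (t : Fin 1 → K) (γ : Fin 1 → Γ) => S (t 0) (γ 0))) {a : α} {j : β} :
    Dfn L v (fun t γ => IsGLB {c | S (t a) c} (γ j)) := by
  have : Dfn L v (fun (t : α → K) (γ : β → Γ) => (∀ c, S (t a) c → γ j ≤ c) ∧
      ∀ m, (∀ c, S (t a) c → m ≤ c) → m ≤ γ j) := by
    refine and (allVal hv (imp (h.app ?_ ?_) (valLe hι ?_ ?_)))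
      (allVal hv (imp (allVal hv (imp (h.app ?_ ?_) (valLe hι ?_ ?_))) (valLe hι ?_ ?_)))
    all_goals first | exact isTermFun_var _ | exact isValTermFun_var _
  exact this

theorem definable₁ {S : Set K}
    (h : Dfn L v (fun (t : Fin 1 → K) (_ : Empty → Γ) => t 0 ∈ S)) :
    (Set.univ : Set K).Definable₁ L S :=
  h.definable

end Dfn

section

variable {L : FirstOrder.Language.{u₁, u₂}} [L.Structure K] {v : AddValuation K (WithTop Γ)}
  {ι : Ldiv →ᴸ L} {a : K} {δ : Γ}

/-- A definable function from residue classes to the value group with finite fibers has finite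
domain. -/
theorem thin_of_thin_fibers_of_functional [DenselyOrdered Γ] [Nontrivial Γ]
    (hv : Function.Surjective v) (hι : ι.reduct K = valuedFieldStructure v)
    (hK : IsCMinimal ι K) {G : K → Γ → Prop}
    (hG : Dfn L v (fun (t : Fin 1 → K) (γ : Fin 1 → Γ) => G (t 0) (γ 0)))
    (hD : ∀ x γ, G x γ → (δ : WithTop Γ) ≤ v (x - a))
    (hfun : ∀ x x' γ γ', G x γ → G x' γ' → (δ : WithTop Γ) < v (x - x') → γ = γ')
    (hfib : ∀ γ, Thin v δ {x | G x γ}) : Thin v δ {x | ∃ γ, G x γ} := by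
  have hT : IsTame {γ | ∃ x, G x γ} := by
    refine isTame_of_dfn hv hι hK ?_
    change Dfn L v (fun (_ : Empty → K) (γ : Fin 1 → Γ) => ∃ x, G x (γ 0))
    exact Dfn.ex (hG.app (isTermFun_var _) (isValTermFun_var _))
  obtain ⟨E, hE, h⟩ := hT
  by_cases hTE : {γ | ∃ x, G x γ} ⊆ E
  · refine (Thin.biUnion hE fun γ _ => hfib γ).mono ?_
    rintro x ⟨γ, hγ⟩
    exact Set.mem_iUnion₂.2 ⟨γ, hTE ⟨x, hγ⟩, hγ⟩
  -- `s` is a value off the breakpoints, so a whole interval (α, β) around it consists of values.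
  obtain ⟨s, hs, hsE⟩ := Set.not_subset.1 hTE
  obtain ⟨β, hβ, hβE⟩ := exists_gt_avoiding hE s
  obtain ⟨α, hα, hαE⟩ := exists_lt_avoiding hE s
  -- Pigeonhole: infinitely many values on finitely many classes would put two values on one class.
  have notThin : ∀ I : Set Γ, I.Infinite → I ⊆ {γ | ∃ x, G x γ} →
      ¬ Thin v δ {x | ∃ γ ∈ I, G x γ} := by
    rintro I hI hIT ⟨F, hF, hcov⟩
    choose! x hx using fun γ hγ => hIT (a := γ) hγ
    choose! e heF he using fun γ (hγ : γ ∈ I) => hcov (x γ) ⟨γ, hγ, hx γ hγ⟩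
    obtain ⟨γ, hγ, γ', hγ', hne, heq⟩ := hI.exists_ne_map_eq_of_mapsTo (f := e) heF hF
    refine hne (hfun _ _ _ _ (hx γ hγ) (hx γ' hγ') (lt_val_sub_trans (he γ hγ) ?_))
    rw [heq, v.map_sub_swap]
    exact he γ' hγ'
  have h₁ : ¬ Thin v δ {x | ∃ γ, γ < s ∧ G x γ} := by
    refine fun hthin => notThin (Set.Ioo α s) (Set.Ioo_infinite hα) ?_ (hthin.mono ?_)
    · intro γ hγ
      refine (h γ s hγ.2.le fun e he hγe => ?_).2 hs
      by_contra! hes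
      rcases hes.lt_or_eq with h1 | h1
      · exact ((hαE e he h1).trans (hγ.1.trans_le hγe)).false
      · exact hsE (h1 ▸ he)
    · rintro x ⟨γ, hγ, hx⟩
      exact ⟨γ, hγ.2, hx⟩
  have h₂ : ¬ Thin v δ {x | ∃ γ, s < γ ∧ G x γ} := by
    refine fun hthin => notThin (Set.Ioo s β) (Set.Ioo_infinite hβ) ?_ (hthin.mono ?_)
    · intro γ hγ
      refine (h s γ hγ.1.le fun e he hse => ?_).1 hs
      rcases hse.lt_or_eq with h1 | h1
      · exact hγ.2.trans (hβE e he h1)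
      · exact absurd (h1 ▸ he) hsE
    · rintro x ⟨γ, hγ, hx⟩
      exact ⟨γ, hγ.1, hx⟩
  have hdef : (Set.univ : Set K).Definable₁ L {x | ∃ γ, γ < s ∧ G x γ} := by
    refine Dfn.definable₁ (v := v) ?_
    change Dfn L v (fun (t : Fin 1 → K) (_ : Empty → Γ) => ∃ γ, γ < s ∧ G (t 0) γ)
    exact Dfn.exVal hv (Dfn.and (Dfn.valLt hι (isValTermFun_var _) (isValTermFun_const hv _))
      (hG.app (isTermFun_var _) (isValTermFun_var _)))
  -- The classes with value below `s` and those with value above `s` are disjoint families, both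
  -- infinite.
  rcases thin_inter_or_thin_diff hι hK hdef a δ with h3 | h3
  · refine absurd (h3.mono ?_) h₁
    rintro x ⟨γ, hγ, hx⟩
    exact ⟨⟨γ, hγ, hx⟩, hD x γ hx⟩
  · refine absurd (h3.mono ?_) h₂
    rintro x ⟨γ, hγ, hx⟩
    refine ⟨hD x γ hx, ?_⟩
    rintro ⟨γ', hγ', hx'⟩
    exact (hγ'.trans hγ).ne (hfun x x γ' γ hx' hx (by simp))

theorem isTame_fiber (hv : Function.Surjective v) (hι : ι.reduct K = valuedFieldStructure v)
    (hK : IsCMinimal ι K) {R : K → Γ → Prop}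
    (hR : Dfn L v (fun (t : Fin 1 → K) (γ : Fin 1 → Γ) => R (t 0) (γ 0))) (x : K) :
    IsTame {γ | R x γ} :=
  isTame_of_dfn hv hι hK (hR.app (isTermFun_const x) (isValTermFun_var _))

/-- Send a class to the infimum of the points above `s` where `R` fails. The fibre over γ > s lies
in the `R`-fibre over any point of (s, γ), hence is thin. If `R` never fails above `s`, the class
lies in the `R`-fibre over any fixed `s' > s`. -/
theorem thin_setOf_right_germ [DenselyOrdered Γ] [Nontrivial Γ] (hv : Function.Surjective v)
    (hι : ι.reduct K = valuedFieldStructure v) (hK : IsCMinimal ι K) {R : K → Γ → Prop}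
    (hR : Dfn L v (fun (t : Fin 1 → K) (γ : Fin 1 → Γ) => R (t 0) (γ 0)))
    (hD : ∀ x γ, R x γ → (δ : WithTop Γ) ≤ v (x - a))
    (hinv : ∀ x x' γ, R x γ → (δ : WithTop Γ) < v (x - x') → R x' γ)
    (hfib : ∀ γ, Thin v δ {x | R x γ}) (s : Γ) :
    Thin v δ {x | ∃ b, s < b ∧ ∀ c, s < c → c < b → R x c} := by
  have hS : Dfn L v (fun (t : Fin 1 → K) (γ : Fin 1 → Γ) => s < γ 0 ∧ ¬ R (t 0) (γ 0)) :=
    (Dfn.valLt hι (isValTermFun_const hv _) (isValTermFun_var _)).and hR.not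
  have hgerm : Dfn L v (fun (t : Fin 1 → K) (_ : Fin 1 → Γ) =>
      ∃ b, s < b ∧ ∀ c, s < c → c < b → R (t 0) c) := by
    refine Dfn.exVal hv (Dfn.and (Dfn.valLt hι ?_ ?_) (Dfn.allVal hv
      (Dfn.imp (Dfn.valLt hι ?_ ?_) (Dfn.imp (Dfn.valLt hι ?_ ?_) (hR.app ?_ ?_)))))
    all_goals first | exact isTermFun_var _ | exact isValTermFun_var _ |
      exact isValTermFun_const hv _
  have key := thin_of_thin_fibers_of_functional hv hι hK (a := a) (δ := δ)
    (G := fun x b => (∃ b, s < b ∧ ∀ c, s < c → c < b → R x c) ∧ IsGLB {c | s < c ∧ ¬ R x c} b)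
    (hgerm.and (Dfn.isGLB hv hι (S := fun x γ => s < γ ∧ ¬ R x γ) hS)) ?_ ?_ ?_
  · obtain ⟨s', hs'⟩ := exists_gt s
    refine (key.union (hfib s')).mono ?_
    rintro x ⟨b, hb, hx⟩
    by_cases hall : ∃ c, s < c ∧ ¬ R x c
    · obtain ⟨e, he⟩ := (isTame_fiber hv hι hK (R := fun x γ => s < γ ∧ ¬ R x γ)
        hS x).exists_isGLB hall ⟨s, fun c hc => hc.1.le⟩
      exact Or.inl ⟨e, ⟨b, hb, hx⟩, he⟩
    · push Not at hall
      exact Or.inr (hall s' hs')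
  · rintro x γ ⟨⟨b, hb, h⟩, -⟩
    obtain ⟨c, hc, hcb⟩ := exists_between hb
    exact hD x c (h c hc hcb)
  · rintro x x' γ γ' ⟨-, h⟩ ⟨-, h'⟩ hxx'
    have : {c | s < c ∧ ¬ R x c} = {c | s < c ∧ ¬ R x' c} := by
      ext c
      refine and_congr_right fun _ => not_congr ⟨fun h => hinv x x' c h hxx', fun h => ?_⟩
      exact hinv x' x c h (by rwa [v.map_sub_swap])
    exact h.unique (this ▸ h')
  · intro γ
    by_cases hγ : s < γ
    · obtain ⟨c, hc, hcγ⟩ := exists_between hγ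
      refine (hfib c).mono ?_
      rintro x ⟨-, h⟩
      by_contra hcx
      exact (h.1 ⟨hc, hcx⟩).not_gt hcγ
    · refine Thin.empty.mono ?_
      rintro x ⟨⟨b, hb, h⟩, h'⟩
      refine hγ (hb.trans_le (h'.2 ?_))
      rintro c ⟨hc, hcx⟩
      by_contra! hcb
      exact hcx (h c hc hcb)

/-- Send a class to the infimum γ of its values above `s`. Either `R` holds at γ, or by tameness it
holds on an interval just above γ; both cases give thin fibres. -/
theorem thin_setOf_exists_gt [DenselyOrdered Γ] [Nontrivial Γ] (hv : Function.Surjective v)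
    (hι : ι.reduct K = valuedFieldStructure v) (hK : IsCMinimal ι K) {R : K → Γ → Prop}
    (hR : Dfn L v (fun (t : Fin 1 → K) (γ : Fin 1 → Γ) => R (t 0) (γ 0)))
    (hD : ∀ x γ, R x γ → (δ : WithTop Γ) ≤ v (x - a))
    (hinv : ∀ x x' γ, R x γ → (δ : WithTop Γ) < v (x - x') → R x' γ)
    (hfib : ∀ γ, Thin v δ {x | R x γ}) (s : Γ) : Thin v δ {x | ∃ γ, s < γ ∧ R x γ} := by
  have hS : Dfn L v (fun (t : Fin 1 → K) (γ : Fin 1 → Γ) => s < γ 0 ∧ R (t 0) (γ 0)) :=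
    (Dfn.valLt hι (isValTermFun_const hv _) (isValTermFun_var _)).and hR
  have hne : Dfn L v (fun (t : Fin 1 → K) (_ : Fin 1 → Γ) => ∃ c, s < c ∧ R (t 0) c) :=
    Dfn.exVal hv (Dfn.app (R := fun x γ => s < γ ∧ R x γ) hS (isTermFun_var _) (isValTermFun_var _))
  have key := thin_of_thin_fibers_of_functional hv hι hK (a := a) (δ := δ)
    (G := fun x b => (∃ c, s < c ∧ R x c) ∧ IsGLB {c | s < c ∧ R x c} b)
    (hne.and (Dfn.isGLB hv hι (S := fun x γ => s < γ ∧ R x γ) hS)) ?_ ?_ ?_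
  · refine key.mono ?_
    rintro x ⟨γ, hγ⟩
    obtain ⟨e, he⟩ := (isTame_fiber hv hι hK (R := fun x γ => s < γ ∧ R x γ)
      hS x).exists_isGLB ⟨γ, hγ⟩ ⟨s, fun c hc => hc.1.le⟩
    exact ⟨e, ⟨γ, hγ⟩, he⟩
  · rintro x γ ⟨⟨c, hc, h⟩, -⟩
    exact hD x c h
  · rintro x x' γ γ' ⟨-, h⟩ ⟨-, h'⟩ hxx'
    have : {c | s < c ∧ R x c} = {c | s < c ∧ R x' c} := by
      ext c
      refine and_congr_right fun _ => ⟨fun h => hinv x x' c h hxx', fun h => ?_⟩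
      exact hinv x' x c h (by rwa [v.map_sub_swap])
    exact h.unique (this ▸ h')
  · intro γ
    refine ((hfib γ).union (thin_setOf_right_germ hv hι hK hR hD hinv hfib γ)).mono ?_
    rintro x ⟨-, h⟩
    by_cases hxγ : R x γ
    · exact Or.inl hxγ
    right
    obtain ⟨b, hb, hb' | hb'⟩ := (isTame_fiber hv hι hK
      (R := fun x γ => s < γ ∧ R x γ) hS x).exists_right_germ γ
    · exact ⟨b, hb, fun c hc hcb => (hb' c hc hcb).2⟩
    · suffices hbl : b ∈ lowerBounds {c | s < c ∧ R x c} from absurd (h.2 hbl) hb.not_ge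
      intro c hc
      have hγc := h.1 hc
      by_contra! hcb
      rcases hγc.lt_or_eq with h1 | h1
      · exact hb' c h1 hcb hc
      · exact hxγ (h1 ▸ hc.2)

/-- A definable relation between residue classes and the value group all of whose fibers over the
value group are finite has finite domain. -/
theorem thin_of_thin_fibers [DenselyOrdered Γ] [Nontrivial Γ] (hv : Function.Surjective v)
    (hι : ι.reduct K = valuedFieldStructure v) (hK : IsCMinimal ι K) {R : K → Γ → Prop}
    (hR : Dfn L v (fun (t : Fin 1 → K) (γ : Fin 1 → Γ) => R (t 0) (γ 0)))
    (hD : ∀ x γ, R x γ → (δ : WithTop Γ) ≤ v (x - a))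
    (hinv : ∀ x x' γ, R x γ → (δ : WithTop Γ) < v (x - x') → R x' γ)
    (hfib : ∀ γ, Thin v δ {x | R x γ}) : Thin v δ {x | ∃ γ, R x γ} := by
  have hneg : Dfn L v (fun (t : Fin 1 → K) (γ : Fin 1 → Γ) => R (t 0) (-γ 0)) := by
    -- Ring terms have no inverses, so -γ is introduced as the solution γ' of γ + γ' = 0.
    have : Dfn L v (fun (t : Fin 1 → K) (γ : Fin 1 → Γ) =>
        ∃ γ', (γ 0 + γ' ≤ 0 ∧ 0 ≤ γ 0 + γ') ∧ R (t 0) γ') :=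
      Dfn.exVal hv (Dfn.and (Dfn.and
        (Dfn.valLe hι ((isValTermFun_var _).add hι (isValTermFun_var _)) (isValTermFun_const hv _))
        (Dfn.valLe hι (isValTermFun_const hv _) ((isValTermFun_var _).add hι (isValTermFun_var _))))
        (hR.app (isTermFun_var _) (isValTermFun_var _)))
    refine this.congr fun t γ => ⟨?_, fun h => ⟨-γ 0, by simp, h⟩⟩
    rintro ⟨γ', h, hγ'⟩
    rwa [← eq_neg_of_add_eq_zero_right (le_antisymm h.1 h.2)]
  -- Infima need a lower bound, so Γ is split at 0 and the negative half is reflected.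
  have h₁ := thin_setOf_exists_gt hv hι hK hR hD hinv hfib 0
  have h₂ := thin_setOf_exists_gt hv hι hK (R := fun x γ => R x (-γ)) hneg
    (fun x γ => hD x _) (fun x x' γ => hinv x x' _) (fun γ => hfib _) 0
  refine ((hfib 0).union (h₁.union h₂)).mono ?_
  rintro x ⟨γ, hγ⟩
  rcases lt_trichotomy 0 γ with h | h | h
  · exact Or.inr (Or.inl ⟨γ, h, hγ⟩)
  · exact Or.inl (h ▸ hγ)
  · exact Or.inr (Or.inr ⟨-γ, by simpa using h, by simpa using hγ⟩)

/-- A definable function from a closed ball to the value group is constant on all but finitely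
many residue classes. -/
theorem thin_setOf_not_constant [DenselyOrdered Γ] [Nontrivial Γ] (hv : Function.Surjective v)
    (hι : ι.reduct K = valuedFieldStructure v) (hK : IsCMinimal ι K) {g : K → Γ → Prop}
    (hg : Dfn L v (fun (t : Fin 1 → K) (γ : Fin 1 → Γ) => g (t 0) (γ 0)))
    (hfun : ∀ x γ γ', g x γ → g x γ' → γ = γ') (a : K) (δ : Γ) :
    Thin v δ {x | (δ : WithTop Γ) ≤ v (x - a) ∧ ∃ y y' : K, ∃ γ γ' : Γ,
      (δ : WithTop Γ) < v (y - x) ∧ (δ : WithTop Γ) < v (y' - x) ∧ g y γ ∧ g y' γ' ∧ γ < γ'} := by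
  -- The second coordinate is a threshold η separating two values of `g` on the class of x.
  have key := thin_of_thin_fibers hv hι hK (a := a) (δ := δ)
    (R := fun x η => (δ : WithTop Γ) ≤ v (x - a) ∧ ∃ y y' : K, ∃ γ γ' : Γ,
      (δ : WithTop Γ) < v (y - x) ∧ (δ : WithTop Γ) < v (y' - x) ∧ g y γ ∧ g y' γ' ∧
        γ ≤ η ∧ η < γ') ?_ ?_ ?_ ?_
  · refine key.mono ?_
    rintro x ⟨hx, y, y', γ, γ', h, h', hy, hy', hlt⟩
    exact ⟨γ, hx, y, y', γ, γ', h, h', hy, hy', le_rfl, hlt⟩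
  · refine Dfn.and (Dfn.le hι ?_ ?_) (Dfn.ex (Dfn.ex (Dfn.exVal hv (Dfn.exVal hv (Dfn.and
      (Dfn.lt hι ?_ ?_) (Dfn.and (Dfn.lt hι ?_ ?_) (Dfn.and (hg.app ?_ ?_) (Dfn.and (hg.app ?_ ?_)
      (Dfn.and (Dfn.valLe hι ?_ ?_) (Dfn.valLt hι ?_ ?_))))))))))
    all_goals first
      | exact isTermFun_var _
      | exact isValTermFun_var _
      | exact (isValTermFun_const hv _).isValuedTerm
      | exact ((isTermFun_var _).sub hι (isTermFun_var _)).isValuedTerm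
      | exact ((isTermFun_var _).sub hι (isTermFun_const _)).isValuedTerm
  · exact fun x γ h => h.1
  · rintro x x' η ⟨hx, y, y', γ, γ', h, h', hrest⟩ hxx'
    refine ⟨?_, y, y', γ, γ', lt_val_sub_trans h hxx', lt_val_sub_trans h' hxx', hrest⟩
    rw [v.map_sub_swap] at hxx'
    exact le_val_sub_trans hxx'.le hx
  · intro η
    -- A class in the fibre over η meets both this set and its complement, and one of the two meets
    -- only finitely many classes.
    have hdef : (Set.univ : Set K).Definable₁ L {y | ∃ γ, g y γ ∧ γ ≤ η} := by
      refine Dfn.definable₁ (v := v) ?_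
      change Dfn L v (fun (t : Fin 1 → K) (_ : Empty → Γ) => ∃ γ, g (t 0) γ ∧ γ ≤ η)
      exact Dfn.exVal hv (Dfn.and (hg.app (isTermFun_var _) (isValTermFun_var _))
        (Dfn.valLe hι (isValTermFun_var _) (isValTermFun_const hv _)))
    rcases thin_inter_or_thin_diff hι hK hdef a δ with ⟨E, hE, h3⟩ | ⟨E, hE, h3⟩
    · refine ⟨E, hE, ?_⟩
      rintro x ⟨hx, y, y', γ, γ', h, h', hy, hy', hlt, hlt'⟩
      obtain ⟨e, he, hye⟩ := h3 y ⟨⟨γ, hy, hlt⟩, le_val_sub_trans h.le hx⟩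
      rw [v.map_sub_swap] at h
      exact ⟨e, he, lt_val_sub_trans h hye⟩
    · refine ⟨E, hE, ?_⟩
      rintro x ⟨hx, y, y', γ, γ', h, h', hy, hy', hlt, hlt'⟩
      have hy'' : y' ∉ {y | ∃ γ, g y γ ∧ γ ≤ η} := by
        rintro ⟨γ₂, h1, h2⟩
        exact (hfun y' _ _ h1 hy' ▸ h2).not_gt hlt'
      obtain ⟨e, he, hye⟩ := h3 y' ⟨le_val_sub_trans h'.le hx, hy''⟩
      rw [v.map_sub_swap] at h'
      exact ⟨e, he, lt_val_sub_trans h' hye⟩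

end

/-! ### The scaling relation of a partial function -/

/-- For the function with graph `g`, the value `v (g x - g y)` is `η` whenever `v (x - y)` is
`γ`. -/
def ScaleRel (v : AddValuation K (WithTop Γ)) (g : K → K → Prop) (x : K) (γ η : Γ) : Prop :=
  ∃ u, g x u ∧ (∃ y z, g y z ∧ v (x - y) = γ ∧ v (u - z) = η) ∧
    ∀ y z, g y z → v (x - y) = γ → v (u - z) = η

/-- Near `x`, the function with graph `g` factorizes over the value group through the scaling
relation at `x`. -/
def FactorsAt (v : AddValuation K (WithTop Γ)) (g : K → K → Prop) (x : K) : Prop :=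
  ∃ ρ : Γ, ∀ y z, (ρ : WithTop Γ) < v (y - x) → (ρ : WithTop Γ) < v (z - x) → ∃ t u, g y t ∧
    g z u ∧ (y ≠ z → ∃ γ η : Γ, v (y - z) = γ ∧ v (t - u) = η ∧ ScaleRel v g x γ η)

theorem ScaleRel.unique {v : AddValuation K (WithTop Γ)} {g : K → K → Prop} {X : Set K}
    {f : K → K} (hg : ∀ x u, g x u ↔ x ∈ X ∧ f x = u) {x : K} {γ η η' : Γ}
    (h : ScaleRel v g x γ η) (h' : ScaleRel v g x γ η') : η = η' := by
  obtain ⟨u, hu, ⟨y, z, hyz, hy, hz⟩, -⟩ := h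
  obtain ⟨u', hu', -, h⟩ := h'
  obtain ⟨-, rfl⟩ := (hg _ _).1 hu
  obtain ⟨-, rfl⟩ := (hg _ _).1 hu'
  exact WithTop.coe_inj.1 (hz.symm.trans (h y z hyz hy))

open Classical in
/-- The value `η` such that `ScaleRel v g x γ η`, and `0` if there is none. -/
noncomputable def scaleFun (v : AddValuation K (WithTop Γ)) (g : K → K → Prop) (x : K) (γ : Γ) :
    Γ :=
  if h : ∃ η, ScaleRel v g x γ η then h.choose else 0

theorem scaleRel_scaleFun {v : AddValuation K (WithTop Γ)} {g : K → K → Prop} {x : K} {γ : Γ}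
    (h : ∃ η, ScaleRel v g x γ η) : ScaleRel v g x γ (scaleFun v g x γ) := by
  rw [scaleFun, dif_pos h]
  exact h.choose_spec

theorem ScaleRel.scaleFun_eq {v : AddValuation K (WithTop Γ)} {g : K → K → Prop} {X : Set K}
    {f : K → K} (hg : ∀ x u, g x u ↔ x ∈ X ∧ f x = u) {x : K} {γ η : Γ}
    (h : ScaleRel v g x γ η) : scaleFun v g x γ = η :=
  (scaleRel_scaleFun ⟨η, h⟩).unique hg h

section

variable {L : FirstOrder.Language.{u₁, u₂}} [L.Structure K] {v : AddValuation K (WithTop Γ)}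
  {ι : Ldiv →ᴸ L} {κ α β : Type}

theorem Dfn.app_graph {g : (κ → K) → K → K → Prop}
    (h : Dfn L v (fun (t : κ ⊕ Fin 2 → K) (_ : Empty → Γ) =>
      g (fun i => t (Sum.inl i)) (t (Sum.inr 0)) (t (Sum.inr 1))))
    {w : κ → (α → K) → K} (hw : ∀ i, IsTermFun L (w i)) {a b : (α → K) → K}
    (ha : IsTermFun L a) (hb : IsTermFun L b) :
    Dfn L v (fun t (_ : β → Γ) => g (fun i => w i t) (a t) (b t)) := by
  refine h.subst (a := Sum.elim w ![a, b]) ?_ (k := fun j _ => j.elim) (fun j => j.elim)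
  rintro (i | i)
  · exact hw i
  · fin_cases i
    exacts [ha, hb]

/-- The parameters indexed by `κ` stay variables of the formula, which is the source of uniformity.
-/
theorem dfn_scaleRel (hι : ι.reduct K = valuedFieldStructure v) {g : (κ → K) → K → K → Prop}
    (h : Dfn L v (fun (t : κ ⊕ Fin 2 → K) (_ : Empty → Γ) =>
      g (fun i => t (Sum.inl i)) (t (Sum.inr 0)) (t (Sum.inr 1)))) :
    Dfn L v (fun (t : κ ⊕ Fin 1 → K) (γ : Fin 2 → Γ) =>
      ScaleRel v (g fun i => t (Sum.inl i)) (t (Sum.inr 0)) (γ 0) (γ 1)) := by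
  refine Dfn.ex (Dfn.and (h.app_graph ?_ ?_ ?_) (Dfn.and (Dfn.ex (Dfn.ex (Dfn.and
    (h.app_graph ?_ ?_ ?_) (Dfn.and (Dfn.valEq hι ?_ ?_) (Dfn.valEq hι ?_ ?_)))))
    (Dfn.all (Dfn.all (Dfn.imp (h.app_graph ?_ ?_ ?_) (Dfn.imp (Dfn.valEq hι ?_ ?_)
      (Dfn.valEq hι ?_ ?_)))))))
  all_goals first
    | exact isTermFun_var _
    | exact fun _ => isTermFun_var _
    | exact (isValTermFun_var _).isValuedTerm
    | exact ((isTermFun_var _).sub hι (isTermFun_var _)).isValuedTerm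

theorem dfn_factorsAt (hv : Function.Surjective v) (hι : ι.reduct K = valuedFieldStructure v)
    {g : (κ → K) → K → K → Prop}
    (h : Dfn L v (fun (t : κ ⊕ Fin 2 → K) (_ : Empty → Γ) =>
      g (fun i => t (Sum.inl i)) (t (Sum.inr 0)) (t (Sum.inr 1)))) :
    Dfn L v (fun (t : κ ⊕ Fin 1 → K) (_ : Empty → Γ) =>
      FactorsAt v (g fun i => t (Sum.inl i)) (t (Sum.inr 0))) := by
  have happ : ∀ {α β : Type} {w : κ → (α → K) → K} (_ : ∀ i, IsTermFun L (w i)) {a : (α → K) → K}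
      (_ : IsTermFun L a) {k k' : (β → Γ) → Γ} (_ : IsValTermFun L v k)
      (_ : IsValTermFun L v k'),
      Dfn L v (fun t γ => ScaleRel v (g fun i => w i t) (a t) (k γ) (k' γ)) := by
    intro α β w hw a ha k k' hk hk'
    refine (dfn_scaleRel hι h).subst (a := Sum.elim w fun _ => a) ?_ (k := ![k, k']) ?_
    · rintro (i | i)
      exacts [hw i, ha]
    · intro j
      fin_cases j
      exacts [hk, hk']
  refine Dfn.exVal hv (Dfn.all (Dfn.all (Dfn.imp (Dfn.lt hι ?_ ?_) (Dfn.imp (Dfn.lt hι ?_ ?_)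
    (Dfn.ex (Dfn.ex (Dfn.and (h.app_graph ?_ ?_ ?_) (Dfn.and (h.app_graph ?_ ?_ ?_)
    (Dfn.imp (Dfn.not (Dfn.eq ?_ ?_)) (Dfn.exVal hv (Dfn.exVal hv (Dfn.and (Dfn.valEq hι ?_ ?_)
    (Dfn.and (Dfn.valEq hι ?_ ?_) (happ ?_ ?_ ?_ ?_))))))))))))))
  all_goals first
    | exact isTermFun_var _
    | exact isValTermFun_var _
    | exact fun _ => isTermFun_var _
    | exact (isValTermFun_var _).isValuedTerm
    | exact ((isTermFun_var _).sub hι (isTermFun_var _)).isValuedTerm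

end

/-! ### Local `C`-isomorphisms -/

section

variable {v : AddValuation K (WithTop Γ)} {B : Set K} {f : K → K}

/-- C(x, y, y) holds exactly when x ≠ y. -/
theorem injOn_of_cRel_iff
    (hf : ∀ x ∈ B, ∀ y ∈ B, ∀ z ∈ B, CRel v x y z ↔ CRel v (f x) (f y) (f z)) :
    Set.InjOn f B := by
  intro x hx y hy hxy
  by_contra hne
  have h : CRel v x y y := ⟨rfl, by
    rw [sub_self, v.map_zero, lt_top_iff_ne_top]
    exact v.ne_top_iff.2 (sub_ne_zero.2 hne)⟩
  have h' := ((hf x hx y hy y hy).1 h).2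
  rw [hxy] at h'
  exact h'.false

/-- If v(f x - f y) < v(f x - f z), then C(f y, f x, f z), hence C(y, x, z), which makes y farther
from x than z is. -/
theorem val_sub_eq_of_cRel_iff
    (hf : ∀ x ∈ B, ∀ y ∈ B, ∀ z ∈ B, CRel v x y z ↔ CRel v (f x) (f y) (f z)) {x y z : K}
    (hx : x ∈ B) (hy : y ∈ B) (hz : z ∈ B) (h : v (x - y) = v (x - z)) :
    v (f x - f y) = v (f x - f z) := by
  have key : ∀ y ∈ B, ∀ z ∈ B, v (x - y) = v (x - z) → ¬ v (f x - f y) < v (f x - f z) := by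
    intro y hy z hz h hlt
    have h1 : CRel v (f y) (f x) (f z) := by
      rw [v.map_sub_swap] at hlt
      have e : f y - f z = (f y - f x) + (f x - f z) := by ring
      refine ⟨?_, ?_⟩
      · rw [e, v.map_add_eq_of_lt_left hlt]
      · rwa [e, v.map_add_eq_of_lt_left hlt]
    have h2 := (hf y hy x hx z hz).2 h1
    have h3 := h2.1 ▸ h2.2
    rw [v.map_sub_swap, h] at h3
    exact h3.false
  exact le_antisymm (not_lt.1 (key z hz y hy h.symm)) (not_lt.1 (key y hy z hz h))

/-- The scaling relation of a `C`-isomorphism `f` on a closed ball. -/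
theorem exists_scaleRel_of_cRel_iff {X : Set K} {g : K → K → Prop}
    (hg : ∀ x u, g x u ↔ x ∈ X ∧ f x = u) (hBX : B ⊆ X)
    (hf : ∀ x ∈ B, ∀ y ∈ B, ∀ z ∈ B, CRel v x y z ↔ CRel v (f x) (f y) (f z)) {a : K} {δ : Γ}
    (hball : ∀ x, (δ : WithTop Γ) ≤ v (x - a) → x ∈ B) {x : K} (hx : (δ : WithTop Γ) ≤ v (x - a))
    {y : K} (hy : (δ : WithTop Γ) ≤ v (y - a)) (hxy : x ≠ y) :
    ∃ γ η : Γ, v (x - y) = γ ∧ v (f x - f y) = η ∧ ScaleRel v g x γ η := by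
  obtain ⟨γ, hγ⟩ := WithTop.ne_top_iff_exists.1 (v.ne_top_iff.2 (sub_ne_zero.2 hxy))
  obtain ⟨η, hη⟩ := WithTop.ne_top_iff_exists.1 (v.ne_top_iff.2 (sub_ne_zero.2
    fun h => hxy (injOn_of_cRel_iff hf (hball x hx) (hball y hy) h)))
  refine ⟨γ, η, hγ.symm, hη.symm, f x, (hg _ _).2 ⟨hBX (hball x hx), rfl⟩,
    ⟨y, f y, (hg _ _).2 ⟨hBX (hball y hy), rfl⟩, hγ.symm, hη.symm⟩, fun z u hz hzγ => ?_⟩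
  obtain ⟨-, rfl⟩ := (hg _ _).1 hz
  rw [hη]
  -- `ScaleRel` ranges over the whole domain, but a point at distance γ ≥ δ from x is back in the
  -- closed ball, where `hf` applies.
  refine val_sub_eq_of_cRel_iff hf (hball x hx) (hball z ?_) (hball y hy) (hzγ.trans hγ)
  have h1 : (δ : WithTop Γ) ≤ v (x - y) := by
    rw [v.map_sub_swap] at hy
    exact le_val_sub_trans hx hy
  rw [← hγ, ← hzγ, v.map_sub_swap] at h1
  exact le_val_sub_trans h1 hx

theorem IsOpenBall.exists_radius (hB : IsOpenBall v B) {a : K} (ha : a ∈ B) :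
    ∃ ρ : Γ, ∀ y, (ρ : WithTop Γ) < v (y - a) → y ∈ B := by
  rcases hB with rfl | ⟨b, ρ, rfl⟩
  · exact ⟨0, fun _ _ => trivial⟩
  · exact ⟨ρ, fun y hy => lt_val_sub_trans hy ha⟩

/-- Even at a bad point the scaling relation has nonempty domain; this makes `Y` project onto the
required set. -/
theorem IsLocalCIso.exists_scaleRel [Nontrivial Γ] (hv : Function.Surjective v) {X : Set K}
    (hf : IsLocalCIso v X f) {g : K → K → Prop} (hg : ∀ x u, g x u ↔ x ∈ X ∧ f x = u) {x : K}
    (hx : x ∈ X) : ∃ γ η, ScaleRel v g x γ η := by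
  obtain ⟨B, hxB, hBX, hB, -, hC⟩ := hf x hx
  obtain ⟨ρ, hρ⟩ := hB.exists_radius hxB
  obtain ⟨δ, hδ⟩ := exists_gt ρ
  obtain ⟨c, hc⟩ := hv δ
  have hxc : x ≠ x - c := fun h => v.ne_top_iff.1 (hc ▸ WithTop.coe_ne_top) (sub_eq_self.1 h.symm)
  obtain ⟨γ, η, -, -, h⟩ := exists_scaleRel_of_cRel_iff hg hBX hC (a := x) (δ := δ)
    (fun y hy => hρ y ((WithTop.coe_lt_coe.2 hδ).trans_le hy)) (x := x) (by simp) (y := x - c)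
    (by rw [v.map_sub_swap, sub_sub_cancel, hc]) hxc
  exact ⟨γ, η, h⟩

theorem locallyFactorizesThrough_of_factorsAt {X F : Set K} {g : K → K → Prop}
    (hg : ∀ x u, g x u ↔ x ∈ X ∧ f x = u) (hF : F.Finite)
    (hXF : ∀ x ∈ X, x ∉ F → FactorsAt v g x) {D : K → Set Γ} {h : K → Γ → Γ}
    (hD : ∀ x ∈ X \ F, ∀ γ η, ScaleRel v g x γ η → γ ∈ D x ∧ h x γ = η) :
    LocallyFactorizesThrough v (X \ F) f D h := by
  intro x hx
  obtain ⟨ρ, hρ⟩ := hXF x hx.1 hx.2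
  -- The ball around x is shrunk to miss the finite set `F`.
  obtain ⟨ρ', hρ'⟩ : ∃ ρ' : Γ, ∀ e ∈ F, ¬ (ρ' : WithTop Γ) < v (e - x) := by
    have hne : ∀ e ∈ F, ∃ γ : Γ, v (e - x) = γ := fun e he =>
      (WithTop.ne_top_iff_exists.1 (v.ne_top_iff.2 (sub_ne_zero.2
        (ne_of_mem_of_not_mem he hx.2)))).imp fun _ h => h.symm
    choose! γ hγ using hne
    obtain ⟨ρ', hρ'⟩ := (hF.image γ).bddAbove
    refine ⟨ρ', fun e he => ?_⟩
    rw [hγ e he, not_lt]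
    exact WithTop.coe_le_coe.2 (hρ' ⟨e, he, rfl⟩)
  have hlt : ∀ y, ((max ρ ρ' : Γ) : WithTop Γ) < v (y - x) →
      (ρ : WithTop Γ) < v (y - x) ∧ (ρ' : WithTop Γ) < v (y - x) := fun y hy =>
    ⟨(WithTop.coe_le_coe.2 (le_max_left _ _)).trans_lt hy,
      (WithTop.coe_le_coe.2 (le_max_right _ _)).trans_lt hy⟩
  refine ⟨{y | ((max ρ ρ' : Γ) : WithTop Γ) < v (y - x)}, Or.inr ⟨x, _, rfl⟩, by simp,
    fun y hy => ⟨?_, fun hyF => hρ' y hyF (hlt y hy).2⟩, fun y hy z hz hyz => ?_⟩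
  -- For equal points `FactorsAt` still asserts membership in the domain.
  · obtain ⟨t, u, hyt, -⟩ := hρ y y (hlt y hy).1 (hlt y hy).1
    exact ((hg _ _).1 hyt).1
  · obtain ⟨t, u, hyt, hzu, hfac⟩ := hρ y z (hlt y hy).1 (hlt z hz).1
    obtain ⟨γ, η, hγ, hη, hs⟩ := hfac hyz
    obtain ⟨-, rfl⟩ := (hg _ _).1 hyt
    obtain ⟨-, rfl⟩ := (hg _ _).1 hzu
    obtain ⟨h1, h2⟩ := hD x hx γ η hs
    exact ⟨γ, h1, hγ, h2 ▸ hη⟩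

end

/-- If infinite, the bad set contains a closed ball on which `f` is a C-isomorphism. Orthogonality
of the residue field and Γ yields a residue class in it on which the scaling does not depend on the
point, so the points of that class are not bad. -/
theorem finite_setOf_not_factorsAt [IsAlgClosed K] [Nontrivial Γ]
    {L : FirstOrder.Language.{u₁, u₂}} [L.Structure K] {v : AddValuation K (WithTop Γ)}
    (hv : Function.Surjective v) {ι : Ldiv →ᴸ L} (hι : ι.reduct K = valuedFieldStructure v)
    (hK : IsCMinimal ι K) {κ : Type} {g : (κ → K) → K → K → Prop}
    (hg : Dfn L v (fun (t : κ ⊕ Fin 2 → K) (_ : Empty → Γ) =>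
      g (fun i => t (Sum.inl i)) (t (Sum.inr 0)) (t (Sum.inr 1)))) {w : κ → K} {X : Set K}
    {f : K → K} (hgw : ∀ x u, g w x u ↔ x ∈ X ∧ f x = u) (hf : IsLocalCIso v X f) :
    {x | x ∈ X ∧ ¬ FactorsAt v (g w) x}.Finite := by
  have hdense := denselyOrdered_of_isAlgClosed hv
  by_contra hinf
  have hdef : (Set.univ : Set K).Definable₁ L {x | x ∈ X ∧ ¬ FactorsAt v (g w) x} := by
    refine Dfn.definable₁ (v := v) ?_
    have : Dfn L v (fun (t : Fin 1 → K) (_ : Empty → Γ) =>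
        (∃ u, g w (t 0) u) ∧ ¬ FactorsAt v (g w) (t 0)) := by
      refine Dfn.and (Dfn.ex (hg.app_graph (fun _ => isTermFun_const _) (isTermFun_var _)
        (isTermFun_var _))) (Dfn.not ?_)
      refine (dfn_factorsAt hv hι hg).subst (a := Sum.elim (fun i _ => w i) fun _ t => t 0) ?_
        (k := fun j => j.elim) (fun j => j.elim)
      rintro (i | i)
      exacts [isTermFun_const _, isTermFun_var _]
    refine this.congr fun t _ => and_congr_left fun _ => ?_
    simp [hgw]
  obtain ⟨E, hE, hloc⟩ := exists_finset_locally_constant hι hK hdef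
  obtain ⟨a, ha, haE⟩ := (Set.not_finite.1 hinf).exists_notMem_finite hE
  obtain ⟨ρ₁, hρ₁⟩ := hloc a haE
  obtain ⟨B, haB, hBX, hB, -, hC⟩ := hf a ha.1
  obtain ⟨ρ₂, hρ₂⟩ := hB.exists_radius haB
  set ρ := max ρ₁ ρ₂
  -- Strictly above `ρ`, so that the closed ball of radius δ fits in both open balls.
  obtain ⟨δ, hδ⟩ := exists_gt ρ
  have hδ₁ : (ρ₁ : WithTop Γ) < δ := WithTop.coe_lt_coe.2 ((le_max_left _ _).trans_lt hδ)
  have hδ₂ : (ρ₂ : WithTop Γ) < δ := WithTop.coe_lt_coe.2 ((le_max_right _ _).trans_lt hδ)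
  have hball : ∀ x, (δ : WithTop Γ) ≤ v (x - a) → x ∈ B := fun x hx => hρ₂ x (hδ₂.trans_le hx)
  have hscale := fun x hx y hy hxy => exists_scaleRel_of_cRel_iff hgw hBX hC hball
    (x := x) hx (y := y) hy hxy
  have huniq : ∀ x γ η η', ScaleRel v (g w) x γ η → ScaleRel v (g w) x γ η' → η = η' :=
    fun _ _ _ _ => ScaleRel.unique hgw
  have hscale_def : ∀ {α β : Type} {a : (α → K) → K} (_ : IsTermFun L a) {k k' : (β → Γ) → Γ}
      (_ : IsValTermFun L v k) (_ : IsValTermFun L v k'),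
      Dfn L v (fun t γ => ScaleRel v (g w) (a t) (k γ) (k' γ)) := by
    intro α β a ha k k' hk hk'
    refine (dfn_scaleRel hι hg).subst (a := Sum.elim (fun i _ => w i) fun _ => a) ?_
      (k := ![k, k']) ?_
    · rintro (i | i)
      exacts [isTermFun_const _, ha]
    · intro j
      fin_cases j
      exacts [hk, hk']
  -- `R x γ` says that the distance γ is scaled differently at two points of the class of x.
  have hthin := thin_of_thin_fibers hv hι hK (a := a) (δ := δ)
    (R := fun x γ => (δ : WithTop Γ) ≤ v (x - a) ∧ ∃ y y' : K, ∃ η η' : Γ,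
      (δ : WithTop Γ) < v (y - x) ∧ (δ : WithTop Γ) < v (y' - x) ∧ ScaleRel v (g w) y γ η ∧
        ScaleRel v (g w) y' γ η' ∧ η < η') ?_ ?_ ?_ ?_
  · have : ∃ x, (δ : WithTop Γ) ≤ v (x - a) ∧ ∀ (y y' : K) (γ η η' : Γ),
        (δ : WithTop Γ) < v (y - x) → (δ : WithTop Γ) < v (y' - x) → ScaleRel v (g w) y γ η →
        ScaleRel v (g w) y' γ η' → η' ≤ η := by
      by_contra! hall
      refine not_thin_closedBall hv a δ (hthin.mono fun x hx => ?_)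
      obtain ⟨y, y', γ, η, η', h⟩ := hall x hx
      exact ⟨γ, hx, y, y', η, η', h⟩
    obtain ⟨x, hx, hconst⟩ := this
    -- x is bad because it is close to `a`; yet δ witnesses factorization at x.
    refine ((hρ₁ x (hδ₁.trans_le hx)).2 ha).2 ⟨δ, fun y z hy hz => ?_⟩
    have hya := le_val_sub_trans hy.le hx
    have hza := le_val_sub_trans hz.le hx
    refine ⟨f y, f z, (hgw _ _).2 ⟨hBX (hball y hya), rfl⟩, (hgw _ _).2 ⟨hBX (hball z hza), rfl⟩,
      fun hyz => ?_⟩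
    obtain ⟨γ, η, hγ, hη, hs⟩ := hscale y hya z hza hyz
    refine ⟨γ, η, hγ, hη, ?_⟩
    have hδγ : (δ : WithTop Γ) ≤ γ := by
      rw [← hγ]
      rw [v.map_sub_swap] at hza
      exact le_val_sub_trans hya hza
    -- x - c is at distance exactly γ from x, so the scaling at x is defined at γ; constancy on the
    -- class equates its value with the one at y.
    obtain ⟨c, hc⟩ := hv γ
    have hxc : x ≠ x - c := fun h => v.ne_top_iff.1 (hc ▸ WithTop.coe_ne_top) (sub_eq_self.1 h.symm)
    have hca : (δ : WithTop Γ) ≤ v (x - c - a) := by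
      refine le_val_sub_trans (y := x) ?_ hx
      rw [v.map_sub_swap, sub_sub_cancel, hc]
      exact hδγ
    obtain ⟨γ', η', hγ', -, hs'⟩ := hscale x hx (x - c) hca hxc
    rw [sub_sub_cancel, hc, WithTop.coe_inj] at hγ'
    subst hγ'
    have hxx : (δ : WithTop Γ) < v (x - x) := by simp
    rwa [le_antisymm (hconst x y _ _ _ hxx hy hs' hs) (hconst y x _ _ _ hy hxx hs hs')]
  · refine Dfn.and (Dfn.le hι ?_ ?_) (Dfn.ex (Dfn.ex (Dfn.exVal hv (Dfn.exVal hv (Dfn.and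
      (Dfn.lt hι ?_ ?_) (Dfn.and (Dfn.lt hι ?_ ?_) (Dfn.and (hscale_def ?_ ?_ ?_)
      (Dfn.and (hscale_def ?_ ?_ ?_) (Dfn.valLt hι ?_ ?_)))))))))
    all_goals first
      | exact isTermFun_var _
      | exact isValTermFun_var _
      | exact (isValTermFun_const hv _).isValuedTerm
      | exact ((isTermFun_var _).sub hι (isTermFun_var _)).isValuedTerm
      | exact ((isTermFun_var _).sub hι (isTermFun_const _)).isValuedTerm
  · exact fun x γ h => h.1
  · rintro x x' γ ⟨hx, y, y', η, η', h, h', hrest⟩ hxx'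
    refine ⟨?_, y, y', η, η', lt_val_sub_trans h hxx', lt_val_sub_trans h' hxx', hrest⟩
    rw [v.map_sub_swap] at hxx'
    exact le_val_sub_trans hxx'.le hx
  · intro γ
    exact thin_setOf_not_constant hv hι hK (g := fun y η => ScaleRel v (g w) y γ η)
      (hscale_def (isTermFun_var _) (isValTermFun_const hv _) (isValTermFun_var _))
      (fun x => huniq x γ) a δ

end CMinimal

/-! ### The main theorem -/

theorem mainTheorem5
    {K : Type u₃} [Field K] [IsAlgClosed K]
    {Γ : Type*} [AddCommGroup Γ] [LinearOrder Γ] [IsOrderedAddMonoid Γ] [Nontrivial Γ]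
    (v : AddValuation K (WithTop Γ)) (hv : Function.Surjective v)
    (L : FirstOrder.Language.{u₁, u₂}) [L.Structure K] (ι : CMinimal.Ldiv →ᴸ L)
    (hι : ι.reduct K = CMinimal.valuedFieldStructure v)
    (hK : CMinimal.IsCMinimal ι K) :
    -- a single function
    (∀ (X : Set K) (f : K → K),
      (Set.univ : Set K).Definable₂ L {p | p.1 ∈ X ∧ f p.1 = p.2} →
      CMinimal.IsLocalCIso v X f →
      ∃ (F : Set K) (Y : Set (K × Γ)) (h : K → Γ → Γ),
        F ⊆ X ∧ F.Finite ∧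
        Prod.fst '' Y = X \ F ∧ CMinimal.DefinableValFun L v Y h ∧
        CMinimal.LocallyFactorizesThrough v (X \ F) f (fun x => {γ | (x, γ) ∈ Y}) h) ∧
    -- uniformly in definable families
    (∀ (n : ℕ) (W : Set (Fin n → K)) (X : Set ((Fin n → K) × K)) (f : (Fin n → K) → K → K),
      (Set.univ : Set K).Definable L W →
      Prod.fst '' X = W →
      CMinimal.DefinableFunFam L X f →
      (∀ w ∈ W, CMinimal.IsLocalCIso v {x | (w, x) ∈ X} (f w)) →
      ∃ (Y : Set (((Fin n → K) × K) × Γ)) (h : (Fin n → K) → K → Γ → Γ)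
        (F : Set ((Fin n → K) × K)),
        Prod.fst '' Y = X ∧ CMinimal.DefinableValFunFam L v Y h ∧
        F ⊆ X ∧ CMinimal.DefinableFam L F ∧
        ∀ w ∈ W, {x | (w, x) ∈ F}.Finite ∧
          CMinimal.LocallyFactorizesThrough v ({x | (w, x) ∈ X} \ {x | (w, x) ∈ F}) (f w)
            (fun x => {γ | ((w, x), γ) ∈ Y}) (h w)) := by
  open CMinimal in
  constructor
  · intro X f hXf hf
    -- A single function is a family with no parameters.
    set g : (Empty → K) → K → K → Prop := fun _ x u => x ∈ X ∧ f x = u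
    have hg : Dfn L v (fun (t : Empty ⊕ Fin 2 → K) (_ : Empty → Γ) =>
        g (fun i => t (Sum.inl i)) (t (Sum.inr 0)) (t (Sum.inr 1))) :=
      (Dfn.of_definable (β := Empty) (v := v) hXf).subst (a := fun i t => t (Sum.inr i))
        (fun _ => isTermFun_var _) (k := fun j => j.elim) (fun j => j.elim)
    have hgw : ∀ x u, g Empty.elim x u ↔ x ∈ X ∧ f x = u := fun _ _ => Iff.rfl
    set F : Set K := {x | x ∈ X ∧ ¬ FactorsAt v (g Empty.elim) x}
    have hFfin : F.Finite := finite_setOf_not_factorsAt hv hι hK hg (w := Empty.elim) hgw hf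
    refine ⟨F, {p | p.1 ∉ F ∧ ∃ η, ScaleRel v (g Empty.elim) p.1 p.2 η},
      scaleFun v (g Empty.elim),
      fun x hx => hx.1, hFfin, ?_, ?_, ?_⟩
    · ext x
      constructor
      · rintro ⟨⟨x, γ⟩, ⟨hxF, η, u, hu, -⟩, rfl⟩
        exact ⟨hu.1, hxF⟩
      · rintro ⟨hx, hxF⟩
        obtain ⟨γ, η, h⟩ := hf.exists_scaleRel hv hgw hx
        exact ⟨(x, γ), ⟨hxF, η, h⟩, rfl⟩
    · refine Dfn.definableVal ?_
      have hs : Dfn L v (fun (t : Fin 1 → K) (γ : Fin 2 → Γ) =>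
          ScaleRel v (g Empty.elim) (t 0) (γ 0) (γ 1)) :=
        (dfn_scaleRel hι hg).subst (a := Sum.elim Empty.elim fun _ t => t 0)
          (by rintro (i | i); exacts [i.elim, isTermFun_var _])
          (k := fun j γ => γ j) (fun _ => isValTermFun_var _)
      have hfac : Dfn L v (fun (t : Fin 1 → K) (_ : Fin 2 → Γ) =>
          FactorsAt v (g Empty.elim) (t 0)) :=
        (dfn_factorsAt hv hι hg).subst (a := Sum.elim Empty.elim fun _ t => t 0)
          (by rintro (i | i); exacts [i.elim, isTermFun_var _])
          (k := fun j => j.elim) (fun j => j.elim)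
      refine (hfac.and hs).congr fun t γ => ?_
      constructor
      · rintro ⟨h1, h2⟩
        exact ⟨⟨fun h => h.2 h1, _, h2⟩, h2.scaleFun_eq hgw⟩
      · rintro ⟨⟨h1, h3⟩, h2⟩
        have h4 : ScaleRel v (g Empty.elim) (t 0) (γ 0) (γ 1) :=
          Eq.subst (motive := ScaleRel v _ _ _) h2 (scaleRel_scaleFun h3)
        obtain ⟨u, hu, -⟩ := id h4
        -- The scaling relation forces the point into `X`, so lying outside `F` amounts to
        -- `FactorsAt`.
        exact ⟨by_contra fun h => h1 ⟨hu.1, h⟩, h4⟩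
    · refine locallyFactorizesThrough_of_factorsAt hgw hFfin
        (fun x hx hxF => by_contra fun h => hxF ⟨hx, h⟩) fun x hx γ η h => ?_
      exact ⟨⟨hx.2, _, h⟩, h.scaleFun_eq hgw⟩
  · intro n W X f _ hXW hXf hf
    set g : (Fin n → K) → K → K → Prop := fun w x u => (w, x) ∈ X ∧ f w x = u
    have hg : Dfn L v (fun (t : Fin n ⊕ Fin 2 → K) (_ : Empty → Γ) =>
        g (fun i => t (Sum.inl i)) (t (Sum.inr 0)) (t (Sum.inr 1))) :=
      Dfn.of_definable hXf
    have hgw : ∀ w x u, g w x u ↔ x ∈ {x | (w, x) ∈ X} ∧ f w x = u := fun _ _ _ => Iff.rfl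
    have hW : ∀ w x, (w, x) ∈ X → w ∈ W := fun w x h => hXW ▸ ⟨_, h, rfl⟩
    -- Here `Y` must project onto all of `X`, so bad points are kept in it.
    refine ⟨{p | ∃ η, ScaleRel v (g p.1.1) p.1.2 p.2 η},
      fun w => scaleFun v (g w),
      {p | p ∈ X ∧ ¬ FactorsAt v (g p.1) p.2}, ?_, ?_, fun p hp => hp.1, ?_, ?_⟩
    · ext ⟨w, x⟩
      constructor
      · rintro ⟨⟨⟨w, x⟩, γ⟩, ⟨η, u, hu, -⟩, h⟩
        exact h ▸ hu.1
      · intro hx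
        obtain ⟨γ, η, h⟩ := IsLocalCIso.exists_scaleRel hv (hf w (hW w x hx)) (hgw w) hx
        exact ⟨((w, x), γ), ⟨η, h⟩, rfl⟩
    · refine Dfn.definableVal ((dfn_scaleRel hι hg).congr fun t γ => ?_)
      constructor
      · intro h2
        exact ⟨⟨_, h2⟩, h2.scaleFun_eq (hgw _)⟩
      · rintro ⟨h3, h2⟩
        exact Eq.subst (motive := ScaleRel v _ _ _) h2 (scaleRel_scaleFun h3)
    · refine Dfn.definable (v := v) (P := fun t _ => ((fun i => t (Sum.inl i)), t (Sum.inr 0)) ∈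
        {p : (Fin n → K) × K | p ∈ X ∧ ¬ FactorsAt v (g p.1) p.2}) ?_
      have : Dfn L v (fun (t : Fin n ⊕ Fin 1 → K) (_ : Empty → Γ) =>
          (∃ u, g (fun i => t (Sum.inl i)) (t (Sum.inr 0)) u) ∧
            ¬ FactorsAt v (g fun i => t (Sum.inl i)) (t (Sum.inr 0))) :=
        Dfn.and (Dfn.ex (hg.app_graph (fun _ => isTermFun_var _) (isTermFun_var _)
          (isTermFun_var _))) (dfn_factorsAt hv hι hg).not
      exact this.congr fun t _ => and_congr_left fun _ =>
        ⟨fun ⟨_, h⟩ => h.1, fun h => ⟨_, h, rfl⟩⟩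
    · intro w hw
      have hFfin := finite_setOf_not_factorsAt hv hι hK hg (hgw w) (hf w hw)
      refine ⟨hFfin, locallyFactorizesThrough_of_factorsAt (hgw w) hFfin
        (fun x hx hxF => by_contra fun h => hxF ⟨hx, h⟩) fun x hx γ η h => ?_⟩
      exact ⟨⟨_, h⟩, h.scaleFun_eq (hgw w)⟩
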